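/- Let $X$ be a topological space. A \emph{cover $\mathcal U$ of level $2$} of $X$ consists of an open cover $\{U_i\}_{i\in I}$ of $X$ together with, for each unordered pair $\{i_0,i_1\}$ of indices, an open cover $\{U_{i_0,i_1,j}\}_{j\in J_{i_0,i_1}}$ of $U_{i_0}\cap U_{i_1}$ (so the data for $(i_0,i_1)$ and $(i_1,i_0)$ are the same), where for $i_0=i_1=i$ the cover consists of the single open set $U_i$. A \emph{refinement} of $\mathcal U$ is a cover $\mathcal U'$ of level $2$ together with a map $\pi:I'\to I$ and, for each unordered pair $\{i_0',i_1'\}$ of indices of $\mathcal U'$, a map $\pi_{i_0',i_1'}:J'_{i_0',i_1'}\to J_{\pi(i_0'),\pi(i_1')}$, such that $U'_{i'}\subseteq U_{\pi(i')}$ and $U'_{i_0',i_1',j'}\subseteq U_{\pi(i_0'),\pi(i_1'),\pi_{i_0',i_1'}(j')}$ always. For a ringed space $(X,\mathcal O_X)$ and an $\mathcal O_X$-module $\mathcal F$, let $C^1(\mathcal U,\mathcal F)=\prod_{i_0,i_1\in I,\ j\in J_{i_0,i_1}}\mathcal F(U_{i_0,i_1,j})$ and $$C^2(\mathcal U,\mathcal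 F)=\prod_{i_0,i_1,i_2\in I}\ \prod_{j_{12}\in J_{i_1,i_2},\,j_{02}\in J_{i_0,i_2},\,j_{01}\in J_{i_0,i_1}}\mathcal F\bigl(U_{i_1,i_2,j_{12}}\cap U_{i_0,i_2,j_{02}}\cap U_{i_0,i_1,j_{01}}\bigr).$$ Let $Z^2(\mathcal U,\mathcal F)\subseteq C^2(\mathcal U,\mathcal F)$ be the submodule of the $\rho$ such that, for all $i_0,i_1,i_2,i_3\in I$ and all $j_{mm'}\in J_{i_m,i_{m'}}$ ($0\le m<m'\le 3$), $$\rho_{i_1,i_2,i_3,j_{23},j_{13},j_{12}}-\rho_{i_0,i_2,i_3,j_{23},j_{03},j_{02}}+\rho_{i_0,i_1,i_3,j_{13},j_{03},j_{01}}-\rho_{i_0,i_1,i_2,j_{12},j_{02},j_{01}}=0$$ on the intersection of the six sets $U_{i_m,i_{m'},j_{mm'}}$. Let $B^2(\mathcal U,\mathcal F)\subseteq Z^2(\mathcal U,\mathcal F)$ be the submodule of the elements $d\rho'$ with $\rho'\in C^1(\mathcal U,\mathcal F)$, where $(d\rho')_{i_0,i_1,i_2,j_{12},j_{02},j_{01}}$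 is the restriction of $\rho'_{i_1,i_2,j_{12}}-\rho'_{i_0,i_2,j_{02}}+\rho'_{i_0,i_1,j_{01}}$. Put $H^2(\mathcal U,\mathcal F)=Z^2(\mathcal U,\mathcal F)/B^2(\mathcal U,\mathcal F)$, a $\Gamma(X,\mathcal O_X)$-module; every refinement $\mathcal U'$ of $\mathcal U$ induces a map $H^2(\mathcal U,\mathcal F)\to H^2(\mathcal U',\mathcal F)$. \textbf{Theorem.} For every ringed space $(X,\mathcal O_X)$ there are $\Gamma(X,\mathcal O_X)$-linear maps $$H^2(\mathcal U,\mathcal F)\to H^2(X,\mathcal F),$$ one for each $\mathcal O_X$-module $\mathcal F$ and each cover $\mathcal U$ of level $2$ of $X$, into the sheaf cohomology of $\mathcal F$, which are natural in $\mathcal F$ and compatible with refinement of $\mathcal U$, and which induce, for every $\mathcal F$, an isomorphism of $\Gamma(X,\mathcal O_X)$-modules $$\varinjlim_{\mathcal U}H^2(\mathcal U,\mathcal F)\ \xrightarrow{\ \sim\ }\ H^2(X,\mathcal F).$$ Here the colimit is taken over all covers of level $2$ and all refinements. The same holds if the colimit is taken over the covers of level $2$ with a linearly ordered index set $I$ and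 those refinements for which $\pi$ is order-preserving. -/

import Mathlib

open CategoryTheory TopologicalSpace Opposite AlgebraicGeometry

universe u

/-! ### Covers of level 2 and their refinements -/

/-- A cover of level `2` of a topological space `X`: an open cover `(U i)` of `X`, and for every
unordered pair `s(i₀, i₁)` an open cover `(V s(i₀, i₁) j)` of `U i₀ ⊓ U i₁`, indexed by
`J s(i₀, i₁)`. The data for `(i₀, i₁)` and for `(i₁, i₀)` are thus the same. The cover of
`U i ⊓ U i` consists of a single open set, which is then `U i` (see `LevelTwoCover.V_diag`). -/
structure LevelTwoCover (X : TopCat.{u}) where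
  I : Type u
  U : I → Opens X
  iSup_U : ⨆ i, U i = ⊤
  J : Sym2 I → Type u
  V : (s : Sym2 I) → J s → Opens X
  unique_diag : ∀ i, Nonempty (Unique (J s(i, i)))
  iSup_V : ∀ i₀ i₁, ⨆ j, V s(i₀, i₁) j = U i₀ ⊓ U i₁

namespace LevelTwoCover

theorem V_diag {X : TopCat.{u}} (𝒰 : LevelTwoCover X) (i : 𝒰.I) (j : 𝒰.J s(i, i)) :
    𝒰.V s(i, i) j = 𝒰.U i := by
  obtain ⟨_⟩ := 𝒰.unique_diag i
  have h := 𝒰.iSup_V i i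
  rw [iSup_unique, inf_idem] at h
  rw [Subsingleton.elim j default, h]

/-- A refinement `𝒰'` of `𝒰`: a map of index sets `I' → I`, and for every pair of indices of `𝒰'`
a map between the corresponding second index sets, compatible with inclusions of open sets. -/
@[ext]
structure Refinement {X : TopCat.{u}} (𝒰' 𝒰 : LevelTwoCover X) where
  idx : 𝒰'.I → 𝒰.I
  idx₂ : (s : Sym2 𝒰'.I) → 𝒰'.J s → 𝒰.J (s.map idx)
  U_le : ∀ i, 𝒰'.U i ≤ 𝒰.U (idx i)
  V_le : ∀ s j, 𝒰'.V s j ≤ 𝒰.V (s.map idx) (idx₂ s j)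

theorem V_cast {X : TopCat.{u}} (𝒰 : LevelTwoCover X) {s t : Sym2 𝒰.I} (h : s = t) (j : 𝒰.J s) :
    𝒰.V t (cast (congrArg 𝒰.J h) j) = 𝒰.V s j := by
  subst h
  rfl

/-- The category of covers of level `2`: a morphism `𝒰' ⟶ 𝒰` exhibits `𝒰'` as a refinement
of `𝒰`. -/
instance {X : TopCat.{u}} : Category.{u} (LevelTwoCover X) where
  Hom 𝒰' 𝒰 := Refinement 𝒰' 𝒰
  id 𝒰 :=
    { idx := id
      idx₂ := fun s j => cast (congrArg 𝒰.J (congrFun Sym2.map_id s).symm) j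
      U_le := fun _ => le_rfl
      V_le := fun s j => (𝒰.V_cast (congrFun Sym2.map_id s).symm j).ge }
  comp {𝒰'' 𝒰' 𝒰} r' r :=
    { idx := r.idx ∘ r'.idx
      idx₂ := fun s j => cast (congrArg 𝒰.J (Sym2.map_map s)) (r.idx₂ _ (r'.idx₂ s j))
      U_le := fun i => (r'.U_le i).trans (r.U_le _)
      V_le := fun s j => ((r'.V_le s j).trans (r.V_le _ _)).trans
        (𝒰.V_cast (Sym2.map_map s) _).ge }
  id_comp r := by
    refine Refinement.ext rfl (heq_of_eq ?_)
    funext s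
    induction s using Sym2.ind
    rfl
  comp_id r := by
    refine Refinement.ext rfl (heq_of_eq ?_)
    funext s
    induction s using Sym2.ind
    rfl
  assoc _ _ _ := by
    refine Refinement.ext rfl (heq_of_eq ?_)
    funext s
    induction s using Sym2.ind
    rfl

end LevelTwoCover

/-- A cover of level `2` together with a linear order on the index set of its first layer. -/
structure OrderedLevelTwoCover (X : TopCat.{u}) extends LevelTwoCover X where
  order : LinearOrder I

/-- Morphisms of ordered covers are the refinements whose map `I' → I` is order-preserving. -/
instance {X : TopCat.{u}} : Category.{u} (OrderedLevelTwoCover X) where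
  Hom 𝒰' 𝒰 := { r : 𝒰'.toLevelTwoCover ⟶ 𝒰.toLevelTwoCover //
    ∀ i₀ i₁, 𝒰'.order.le i₀ i₁ → 𝒰.order.le (r.idx i₀) (r.idx i₁) }
  id 𝒰 := ⟨𝟙 𝒰.toLevelTwoCover, fun _ _ h => h⟩
  comp r' r := ⟨r'.1 ≫ r.1, fun i₀ i₁ h => r.2 _ _ (r'.2 i₀ i₁ h)⟩
  id_comp r := Subtype.ext (Category.id_comp r.1)
  comp_id r := Subtype.ext (Category.comp_id r.1)
  assoc r s t := Subtype.ext (Category.assoc r.1 s.1 t.1)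

/-- The functor that forgets the orders on the index sets. -/
def OrderedLevelTwoCover.forgetOrder (X : TopCat.{u}) :
    OrderedLevelTwoCover X ⥤ LevelTwoCover X where
  obj 𝒰 := 𝒰.toLevelTwoCover
  map r := r.1

/-! ### The module `H²(𝒰, G)`

Here `G` is a presheaf of `R`-modules on `X`. -/

namespace LevelTwoCover

section Cochains

variable {X : TopCat.{u}} {R : Type u} [Ring R]

/-- Restriction of sections. -/
noncomputable def res (G : (Opens X)ᵒᵖ ⥤ ModuleCat.{u} R) {U V : Opens X} (h : U ≤ V) :
    G.obj (op V) →ₗ[R] G.obj (op U) :=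
  (G.map (homOfLE h).op).hom

theorem res_res (G : (Opens X)ᵒᵖ ⥤ ModuleCat.{u} R) {U V W : Opens X} (h : U ≤ V) (h' : V ≤ W)
    (x : G.obj (op W)) : res G h (res G h' x) = res G (h.trans h') x := by
  have e : (homOfLE (h.trans h')).op = (homOfLE h').op ≫ (homOfLE h).op := rfl
  simp only [res]
  rw [e, G.map_comp]
  rfl

theorem res_naturality {G G' : (Opens X)ᵒᵖ ⥤ ModuleCat.{u} R} (f : G ⟶ G') {U V : Opens X}
    (h : U ≤ V) (x : G.obj (op V)) :
    (f.app (op U)).hom (res G h x) = res G' h ((f.app (op V)).hom x) :=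
  NatTrans.naturality_apply f (homOfLE h).op x

variable (𝒰 : LevelTwoCover X)

/-- The open set `U_{𝐢,𝐣}` for `𝐢 = (i₀, i₁, i₂)` and `𝐣 = (j₁₂, j₀₂, j₀₁)`. -/
def inter₃ {i₀ i₁ i₂ : 𝒰.I} (j₁₂ : 𝒰.J s(i₁, i₂)) (j₀₂ : 𝒰.J s(i₀, i₂)) (j₀₁ : 𝒰.J s(i₀, i₁)) :
    Opens X :=
  𝒰.V _ j₁₂ ⊓ 𝒰.V _ j₀₂ ⊓ 𝒰.V _ j₀₁

/-- The intersection of the six open sets attached to the pairs in `{i₀, i₁, i₂, i₃}`. -/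
def inter₆ {i₀ i₁ i₂ i₃ : 𝒰.I} (j₂₃ : 𝒰.J s(i₂, i₃)) (j₁₃ : 𝒰.J s(i₁, i₃))
    (j₁₂ : 𝒰.J s(i₁, i₂)) (j₀₃ : 𝒰.J s(i₀, i₃)) (j₀₂ : 𝒰.J s(i₀, i₂)) (j₀₁ : 𝒰.J s(i₀, i₁)) :
    Opens X :=
  (𝒰.V _ j₂₃ ⊓ 𝒰.V _ j₁₃ ⊓ 𝒰.V _ j₁₂) ⊓ (𝒰.V _ j₀₃ ⊓ 𝒰.V _ j₀₂ ⊓ 𝒰.V _ j₀₁)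

variable {𝒰}

theorem inter₃_le₁₂ {i₀ i₁ i₂ : 𝒰.I} (j₁₂ : 𝒰.J s(i₁, i₂)) (j₀₂ : 𝒰.J s(i₀, i₂))
    (j₀₁ : 𝒰.J s(i₀, i₁)) : 𝒰.inter₃ j₁₂ j₀₂ j₀₁ ≤ 𝒰.V _ j₁₂ :=
  inf_le_left.trans inf_le_left

theorem inter₃_le₀₂ {i₀ i₁ i₂ : 𝒰.I} (j₁₂ : 𝒰.J s(i₁, i₂)) (j₀₂ : 𝒰.J s(i₀, i₂))
    (j₀₁ : 𝒰.J s(i₀, i₁)) : 𝒰.inter₃ j₁₂ j₀₂ j₀₁ ≤ 𝒰.V _ j₀₂ :=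
  inf_le_left.trans inf_le_right

theorem inter₃_le₀₁ {i₀ i₁ i₂ : 𝒰.I} (j₁₂ : 𝒰.J s(i₁, i₂)) (j₀₂ : 𝒰.J s(i₀, i₂))
    (j₀₁ : 𝒰.J s(i₀, i₁)) : 𝒰.inter₃ j₁₂ j₀₂ j₀₁ ≤ 𝒰.V _ j₀₁ :=
  inf_le_right

section

variable {i₀ i₁ i₂ i₃ : 𝒰.I} (j₂₃ : 𝒰.J s(i₂, i₃)) (j₁₃ : 𝒰.J s(i₁, i₃))
    (j₁₂ : 𝒰.J s(i₁, i₂)) (j₀₃ : 𝒰.J s(i₀, i₃)) (j₀₂ : 𝒰.J s(i₀, i₂)) (j₀₁ : 𝒰.J s(i₀, i₁))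

theorem inter₆_le₁₂₃ : 𝒰.inter₆ j₂₃ j₁₃ j₁₂ j₀₃ j₀₂ j₀₁ ≤ 𝒰.inter₃ j₂₃ j₁₃ j₁₂ :=
  inf_le_left

theorem inter₆_le₀₂₃ : 𝒰.inter₆ j₂₃ j₁₃ j₁₂ j₀₃ j₀₂ j₀₁ ≤ 𝒰.inter₃ j₂₃ j₀₃ j₀₂ := fun _ hx =>
  ⟨⟨hx.1.1.1, hx.2.1.1⟩, hx.2.1.2⟩

theorem inter₆_le₀₁₃ : 𝒰.inter₆ j₂₃ j₁₃ j₁₂ j₀₃ j₀₂ j₀₁ ≤ 𝒰.inter₃ j₁₃ j₀₃ j₀₁ := fun _ hx =>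
  ⟨⟨hx.1.1.2, hx.2.1.1⟩, hx.2.2⟩

theorem inter₆_le₀₁₂ : 𝒰.inter₆ j₂₃ j₁₃ j₁₂ j₀₃ j₀₂ j₀₁ ≤ 𝒰.inter₃ j₁₂ j₀₂ j₀₁ := fun _ hx =>
  ⟨⟨hx.1.2, hx.2.1.2⟩, hx.2.2⟩

end

variable (𝒰) (G : (Opens X)ᵒᵖ ⥤ ModuleCat.{u} R)

/-- The module of `1`-cochains. -/
abbrev C1 : Type u :=
  (i₀ i₁ : 𝒰.I) → (j : 𝒰.J s(i₀, i₁)) → G.obj (op (𝒰.V _ j))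

/-- The module of `2`-cochains. -/
abbrev C2 : Type u :=
  (i₀ i₁ i₂ : 𝒰.I) → (j₁₂ : 𝒰.J s(i₁, i₂)) → (j₀₂ : 𝒰.J s(i₀, i₂)) → (j₀₁ : 𝒰.J s(i₀, i₁)) →
    G.obj (op (𝒰.inter₃ j₁₂ j₀₂ j₀₁))

/-- The module in which the cocycle condition for `2`-cochains takes its values. -/
abbrev C3 : Type u :=
  (i₀ i₁ i₂ i₃ : 𝒰.I) → (j₂₃ : 𝒰.J s(i₂, i₃)) → (j₁₃ : 𝒰.J s(i₁, i₃)) →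
    (j₁₂ : 𝒰.J s(i₁, i₂)) → (j₀₃ : 𝒰.J s(i₀, i₃)) → (j₀₂ : 𝒰.J s(i₀, i₂)) →
    (j₀₁ : 𝒰.J s(i₀, i₁)) → G.obj (op (𝒰.inter₆ j₂₃ j₁₃ j₁₂ j₀₃ j₀₂ j₀₁))

/-- The differential from `1`-cochains to `2`-cochains. -/
noncomputable def d1 : 𝒰.C1 G →ₗ[R] 𝒰.C2 G where
  toFun ρ := fun i₀ i₁ i₂ j₁₂ j₀₂ j₀₁ =>
    res G (inter₃_le₁₂ j₁₂ j₀₂ j₀₁) (ρ i₁ i₂ j₁₂)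
      - res G (inter₃_le₀₂ j₁₂ j₀₂ j₀₁) (ρ i₀ i₂ j₀₂)
      + res G (inter₃_le₀₁ j₁₂ j₀₂ j₀₁) (ρ i₀ i₁ j₀₁)
  map_add' ρ ρ' := by
    funext i₀ i₁ i₂ j₁₂ j₀₂ j₀₁
    simp only [Pi.add_apply, map_add]
    abel
  map_smul' a ρ := by
    funext i₀ i₁ i₂ j₁₂ j₀₂ j₀₁
    simp only [Pi.smul_apply, map_smul, RingHom.id_apply, smul_add, smul_sub]

/-- The differential whose kernel is the module of `2`-cocycles. -/
noncomputable def d2 : 𝒰.C2 G →ₗ[R] 𝒰.C3 G where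
  toFun ρ := fun i₀ i₁ i₂ i₃ j₂₃ j₁₃ j₁₂ j₀₃ j₀₂ j₀₁ =>
    res G (inter₆_le₁₂₃ j₂₃ j₁₃ j₁₂ j₀₃ j₀₂ j₀₁) (ρ i₁ i₂ i₃ j₂₃ j₁₃ j₁₂)
      - res G (inter₆_le₀₂₃ j₂₃ j₁₃ j₁₂ j₀₃ j₀₂ j₀₁) (ρ i₀ i₂ i₃ j₂₃ j₀₃ j₀₂)
      + res G (inter₆_le₀₁₃ j₂₃ j₁₃ j₁₂ j₀₃ j₀₂ j₀₁) (ρ i₀ i₁ i₃ j₁₃ j₀₃ j₀₁)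
      - res G (inter₆_le₀₁₂ j₂₃ j₁₃ j₁₂ j₀₃ j₀₂ j₀₁) (ρ i₀ i₁ i₂ j₁₂ j₀₂ j₀₁)
  map_add' ρ ρ' := by
    funext i₀ i₁ i₂ i₃ j₂₃ j₁₃ j₁₂ j₀₃ j₀₂ j₀₁
    simp only [Pi.add_apply, map_add]
    abel
  map_smul' a ρ := by
    funext i₀ i₁ i₂ i₃ j₂₃ j₁₃ j₁₂ j₀₃ j₀₂ j₀₁
    simp only [Pi.smul_apply, map_smul, RingHom.id_apply, smul_add, smul_sub]

theorem d2_d1 (ρ : 𝒰.C1 G) : 𝒰.d2 G (𝒰.d1 G ρ) = 0 := by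
  funext i₀ i₁ i₂ i₃ j₂₃ j₁₃ j₁₂ j₀₃ j₀₂ j₀₁
  simp only [d1, d2, LinearMap.coe_mk, AddHom.coe_mk, map_add, map_sub, res_res, Pi.zero_apply]
  abel

/-- The module `Z²(𝒰, G)` of cocycles. -/
noncomputable def Z2 : Submodule R (𝒰.C2 G) := LinearMap.ker (𝒰.d2 G)

/-- The submodule `B²(𝒰, G)` of `Z²(𝒰, G)` consisting of the coboundaries. -/
noncomputable def B2 : Submodule R (𝒰.Z2 G) :=
  LinearMap.range ((𝒰.d1 G).codRestrict (𝒰.Z2 G) fun ρ => LinearMap.mem_ker.2 (𝒰.d2_d1 G ρ))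

/-- `H²(𝒰, G) = Z²(𝒰, G) / B²(𝒰, G)`. -/
abbrev H2 : Type u := 𝒰.Z2 G ⧸ 𝒰.B2 G

variable {𝒰} {G}

/-- The map on `2`-cochains induced by a morphism of presheaves. -/
noncomputable def C2map (𝒰 : LevelTwoCover X) {G G' : (Opens X)ᵒᵖ ⥤ ModuleCat.{u} R} (f : G ⟶ G') :
    𝒰.C2 G →ₗ[R] 𝒰.C2 G' where
  toFun ρ := fun i₀ i₁ i₂ j₁₂ j₀₂ j₀₁ => (f.app _).hom (ρ i₀ i₁ i₂ j₁₂ j₀₂ j₀₁)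
  map_add' ρ ρ' := by
    funext i₀ i₁ i₂ j₁₂ j₀₂ j₀₁
    simp only [Pi.add_apply, map_add]
  map_smul' a ρ := by
    funext i₀ i₁ i₂ j₁₂ j₀₂ j₀₁
    simp only [Pi.smul_apply, map_smul, RingHom.id_apply]

theorem C2map_mem (𝒰 : LevelTwoCover X) {G G' : (Opens X)ᵒᵖ ⥤ ModuleCat.{u} R} (f : G ⟶ G')
    (ρ : 𝒰.C2 G) (hρ : ρ ∈ 𝒰.Z2 G) : 𝒰.C2map f ρ ∈ 𝒰.Z2 G' := by
  refine LinearMap.mem_ker.2 ?_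
  funext i₀ i₁ i₂ i₃ j₂₃ j₁₃ j₁₂ j₀₃ j₀₂ j₀₁
  have h := congrArg (f.app _).hom
    (congrFun (congrFun (congrFun (congrFun (congrFun (congrFun (congrFun (congrFun (congrFun
      (congrFun (LinearMap.mem_ker.1 hρ) i₀) i₁) i₂) i₃) j₂₃) j₁₃) j₁₂) j₀₃) j₀₂) j₀₁)
  simpa only [d2, C2map, LinearMap.coe_mk, AddHom.coe_mk, map_add, map_sub, res_naturality,
    Pi.zero_apply, map_zero] using h

/-- The map on cocycles induced by a morphism of presheaves. -/
noncomputable def Z2map (𝒰 : LevelTwoCover X) {G G' : (Opens X)ᵒᵖ ⥤ ModuleCat.{u} R} (f : G ⟶ G') :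
    𝒰.Z2 G →ₗ[R] 𝒰.Z2 G' :=
  (𝒰.C2map f).restrict (𝒰.C2map_mem f)

theorem B2_le_comap_Z2map (𝒰 : LevelTwoCover X) {G G' : (Opens X)ᵒᵖ ⥤ ModuleCat.{u} R}
    (f : G ⟶ G') : 𝒰.B2 G ≤ (𝒰.B2 G').comap (𝒰.Z2map f) := by
  rintro _ ⟨ρ, rfl⟩
  refine ⟨fun i₀ i₁ j => (f.app _).hom (ρ i₀ i₁ j), Subtype.ext ?_⟩
  funext i₀ i₁ i₂ j₁₂ j₀₂ j₀₁
  simp only [d1, C2map, Z2map, LinearMap.codRestrict_apply, LinearMap.coe_restrict_apply,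
    LinearMap.coe_mk, AddHom.coe_mk, map_add, map_sub, res_naturality]

/-- The map `H²(𝒰, G) → H²(𝒰, G')` induced by a morphism of presheaves `G ⟶ G'`. -/
noncomputable def H2map (𝒰 : LevelTwoCover X) {G G' : (Opens X)ᵒᵖ ⥤ ModuleCat.{u} R} (f : G ⟶ G') :
    𝒰.H2 G →ₗ[R] 𝒰.H2 G' :=
  Submodule.mapQ _ _ (𝒰.Z2map f) (𝒰.B2_le_comap_Z2map f)

section Refine

variable {𝒰' 𝒰 : LevelTwoCover X} (r : 𝒰' ⟶ 𝒰) (G : (Opens X)ᵒᵖ ⥤ ModuleCat.{u} R)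

/-- The map of second index sets for the ordered pair `(i₀, i₁)`. -/
def Refinement.idxJ {i₀ i₁ : 𝒰'.I} (j : 𝒰'.J s(i₀, i₁)) : 𝒰.J s(r.idx i₀, r.idx i₁) :=
  r.idx₂ s(i₀, i₁) j

theorem Refinement.V_le_idxJ {i₀ i₁ : 𝒰'.I} (j : 𝒰'.J s(i₀, i₁)) :
    𝒰'.V _ j ≤ 𝒰.V _ (Refinement.idxJ r j) :=
  r.V_le s(i₀, i₁) j

theorem Refinement.inter₃_le {i₀ i₁ i₂ : 𝒰'.I} (j₁₂ : 𝒰'.J s(i₁, i₂)) (j₀₂ : 𝒰'.J s(i₀, i₂))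
    (j₀₁ : 𝒰'.J s(i₀, i₁)) :
    𝒰'.inter₃ j₁₂ j₀₂ j₀₁ ≤ 𝒰.inter₃ (Refinement.idxJ r j₁₂) (Refinement.idxJ r j₀₂) (Refinement.idxJ r j₀₁) :=
  inf_le_inf (inf_le_inf (Refinement.V_le_idxJ r _) (Refinement.V_le_idxJ r _)) (Refinement.V_le_idxJ r _)

theorem Refinement.inter₆_le {i₀ i₁ i₂ i₃ : 𝒰'.I} (j₂₃ : 𝒰'.J s(i₂, i₃)) (j₁₃ : 𝒰'.J s(i₁, i₃))
    (j₁₂ : 𝒰'.J s(i₁, i₂)) (j₀₃ : 𝒰'.J s(i₀, i₃)) (j₀₂ : 𝒰'.J s(i₀, i₂))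
    (j₀₁ : 𝒰'.J s(i₀, i₁)) :
    𝒰'.inter₆ j₂₃ j₁₃ j₁₂ j₀₃ j₀₂ j₀₁ ≤
      𝒰.inter₆ (Refinement.idxJ r j₂₃) (Refinement.idxJ r j₁₃) (Refinement.idxJ r j₁₂) (Refinement.idxJ r j₀₃) (Refinement.idxJ r j₀₂)
        (Refinement.idxJ r j₀₁) :=
  inf_le_inf (inf_le_inf (inf_le_inf (Refinement.V_le_idxJ r _) (Refinement.V_le_idxJ r _)) (Refinement.V_le_idxJ r _))
    (inf_le_inf (inf_le_inf (Refinement.V_le_idxJ r _) (Refinement.V_le_idxJ r _)) (Refinement.V_le_idxJ r _))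

/-- The map on `2`-cochains induced by a refinement. -/
noncomputable def C2refine : 𝒰.C2 G →ₗ[R] 𝒰'.C2 G where
  toFun ρ := fun i₀ i₁ i₂ j₁₂ j₀₂ j₀₁ =>
    res G (Refinement.inter₃_le r j₁₂ j₀₂ j₀₁)
      (ρ (r.idx i₀) (r.idx i₁) (r.idx i₂) (Refinement.idxJ r j₁₂) (Refinement.idxJ r j₀₂) (Refinement.idxJ r j₀₁))
  map_add' ρ ρ' := by
    funext i₀ i₁ i₂ j₁₂ j₀₂ j₀₁
    simp only [Pi.add_apply, map_add]
  map_smul' a ρ := by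
    funext i₀ i₁ i₂ j₁₂ j₀₂ j₀₁
    simp only [Pi.smul_apply, map_smul, RingHom.id_apply]

theorem C2refine_mem (ρ : 𝒰.C2 G) (hρ : ρ ∈ 𝒰.Z2 G) : C2refine r G ρ ∈ 𝒰'.Z2 G := by
  refine LinearMap.mem_ker.2 ?_
  funext i₀ i₁ i₂ i₃ j₂₃ j₁₃ j₁₂ j₀₃ j₀₂ j₀₁
  have h := congrArg (res G (Refinement.inter₆_le r j₂₃ j₁₃ j₁₂ j₀₃ j₀₂ j₀₁))
    (congrFun (congrFun (congrFun (congrFun (congrFun (congrFun (congrFun (congrFun (congrFun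
      (congrFun (LinearMap.mem_ker.1 hρ) (r.idx i₀)) (r.idx i₁)) (r.idx i₂)) (r.idx i₃))
      (Refinement.idxJ r j₂₃)) (Refinement.idxJ r j₁₃)) (Refinement.idxJ r j₁₂)) (Refinement.idxJ r j₀₃)) (Refinement.idxJ r j₀₂))
      (Refinement.idxJ r j₀₁))
  simp only [d2, C2refine, LinearMap.coe_mk, AddHom.coe_mk, map_add, map_sub, res_res,
    Pi.zero_apply, map_zero] at h ⊢
  exact h

/-- The map on cocycles induced by a refinement. -/
noncomputable def Z2refine : 𝒰.Z2 G →ₗ[R] 𝒰'.Z2 G :=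
  (C2refine r G).restrict (C2refine_mem r G)

theorem B2_le_comap_Z2refine : 𝒰.B2 G ≤ (𝒰'.B2 G).comap (Z2refine r G) := by
  rintro _ ⟨ρ, rfl⟩
  refine ⟨fun i₀ i₁ j => res G (Refinement.V_le_idxJ r j) (ρ (r.idx i₀) (r.idx i₁) (Refinement.idxJ r j)),
    Subtype.ext ?_⟩
  funext i₀ i₁ i₂ j₁₂ j₀₂ j₀₁
  simp only [d1, C2refine, Z2refine, LinearMap.codRestrict_apply, LinearMap.coe_restrict_apply,
    LinearMap.coe_mk, AddHom.coe_mk, map_add, map_sub, res_res]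

/-- The map `H²(𝒰, G) → H²(𝒰', G)` induced by a refinement `𝒰'` of `𝒰`. -/
noncomputable def H2refine : 𝒰.H2 G →ₗ[R] 𝒰'.H2 G :=
  Submodule.mapQ _ _ (Z2refine r G) (B2_le_comap_Z2refine r G)

end Refine

/-- The modules `H²(𝒰, G)`, for all covers `𝒰` of level `2`, with the refinement maps. -/
noncomputable def H2diagram (G : (Opens X)ᵒᵖ ⥤ ModuleCat.{u} R) :
    (LevelTwoCover X)ᵒᵖ ⥤ ModuleCat.{u} R where
  obj 𝒰 := ModuleCat.of R (𝒰.unop.H2 G)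
  map r := ModuleCat.ofHom (H2refine r.unop G)
  map_id 𝒰 := by
    refine ModuleCat.hom_ext (Submodule.linearMap_qext _ (LinearMap.ext fun ρ => ?_))
    refine congrArg (Submodule.Quotient.mk (p := 𝒰.unop.B2 G)) (Subtype.ext ?_)
    funext i₀ i₁ i₂ j₁₂ j₀₂ j₀₁
    exact congrArg (fun φ => φ.hom (ρ.1 i₀ i₁ i₂ j₁₂ j₀₂ j₀₁))
      (G.map_id (op (𝒰.unop.inter₃ j₁₂ j₀₂ j₀₁)))
  map_comp {𝒰 𝒰' 𝒰''} r r' := by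
    refine ModuleCat.hom_ext (Submodule.linearMap_qext _ (LinearMap.ext fun ρ => ?_))
    refine congrArg (Submodule.Quotient.mk (p := 𝒰''.unop.B2 G)) (Subtype.ext ?_)
    funext i₀ i₁ i₂ j₁₂ j₀₂ j₀₁
    exact (res_res G (Refinement.inter₃_le r'.unop j₁₂ j₀₂ j₀₁)
      (Refinement.inter₃_le r.unop _ _ _) _).symm

end Cochains

end LevelTwoCover

/-! ### Modules on a ringed space and their cohomology -/

namespace AlgebraicGeometry.RingedSpace

variable (X : RingedSpace.{u, u})

/-- The structure sheaf, as a sheaf of rings. -/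
noncomputable abbrev ringSheaf : TopCat.Sheaf RingCat.{u} X.carrier :=
  (sheafCompose (Opens.grothendieckTopology X.carrier) (forget₂ CommRingCat.{u} RingCat.{u})).obj
    X.sheaf

/-- The category of `𝒪_X`-modules. -/
abbrev Modules := SheafOfModules.{u} X.ringSheaf

/-- The ring `Γ(X, 𝒪_X)`. -/
abbrev GlobalSections : Type u := X.ringSheaf.obj.obj (op ⊤)

/-- An `𝒪_X`-module, viewed as a presheaf of `Γ(X, 𝒪_X)`-modules through the restriction
maps `Γ(X, 𝒪_X) → 𝒪_X(U)`. -/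
noncomputable abbrev toPresheafModuleCat :
    X.Modules ⥤ ((Opens X.carrier)ᵒᵖ ⥤ ModuleCat.{u} X.GlobalSections) :=
  SheafOfModules.forget X.ringSheaf ⋙
    PresheafOfModules.forgetToPresheafModuleCat (op ⊤)
      (Limits.initialOpOfTerminal Limits.isTerminalTop)

variable {X}

/-- The underlying sheaf of abelian groups of an `𝒪_X`-module. -/
noncomputable abbrev toAbSheaf (F : X.Modules) :
    Sheaf (Opens.grothendieckTopology X.carrier) AddCommGrpCat.{u} :=
  (SheafOfModules.toSheaf X.ringSheaf).obj F

/-- Multiplication by a global section `a` of `𝒪_X`, as an endomorphism of the underlying sheaf of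
abelian groups of an `𝒪_X`-module. -/
noncomputable def smulHom (F : X.Modules) (a : X.GlobalSections) : toAbSheaf F ⟶ toAbSheaf F where
  hom :=
    { app := fun U => (((X.toPresheafModuleCat).obj F).obj U).smul a
      naturality := fun _ _ i => ModuleCat.smul_naturality (((X.toPresheafModuleCat).obj F).map i) a }

/-- The sheaf cohomology group `H²(X, ℱ)` of an `𝒪_X`-module. -/
abbrev H2 (F : X.Modules) : Type u := Sheaf.H (toAbSheaf F) 2

theorem smulHom_one (F : X.Modules) : smulHom F 1 = 𝟙 _ := by
  ext U x
  exact MulAction.one_smul (α := X.GlobalSections)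
    (β := ModuleCat.carrier ((X.toPresheafModuleCat.obj F).obj U)) x

theorem smulHom_mul (F : X.Modules) (a b : X.GlobalSections) :
    smulHom F (a * b) = smulHom F b ≫ smulHom F a := by
  ext U x
  exact SemigroupAction.mul_smul (β := ModuleCat.carrier ((X.toPresheafModuleCat.obj F).obj U)) a b x

theorem smulHom_add (F : X.Modules) (a b : X.GlobalSections) :
    smulHom F (a + b) = smulHom F a + smulHom F b := by
  ext U x
  exact add_smul (M := ModuleCat.carrier ((X.toPresheafModuleCat.obj F).obj U)) a b x

/-- `Γ(X, 𝒪_X)` acts on `H²(X, ℱ)` by functoriality of cohomology. -/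
noncomputable instance (F : X.Modules) : Module X.GlobalSections (H2 F) where
  smul a x := Sheaf.H.map (smulHom F a) 2 x
  one_smul x := by
    change Sheaf.H.map (smulHom F 1) 2 x = x
    rw [smulHom_one, Sheaf.H.map_id_apply]
  mul_smul a b x := by
    change Sheaf.H.map (smulHom F (a * b)) 2 x =
      Sheaf.H.map (smulHom F a) 2 (Sheaf.H.map (smulHom F b) 2 x)
    rw [smulHom_mul, Sheaf.H.map_comp_apply]
  smul_zero a := map_zero (Sheaf.H.map (smulHom F a) 2)
  smul_add a := map_add (Sheaf.H.map (smulHom F a) 2)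
  add_smul a b x := by
    change Sheaf.H.map (smulHom F (a + b)) 2 x =
      Sheaf.H.map (smulHom F a) 2 x + Sheaf.H.map (smulHom F b) 2 x
    rw [smulHom_add, Sheaf.H.map_add_apply]
  zero_smul x := by
    change Sheaf.H.map (smulHom F 0) 2 x = 0
    have h : Sheaf.H.map (smulHom F (0 + 0)) 2 x =
        Sheaf.H.map (smulHom F 0) 2 x + Sheaf.H.map (smulHom F 0) 2 x := by
      rw [smulHom_add, Sheaf.H.map_add_apply]
    rw [add_zero] at h
    exact left_eq_add.1 h

/-- The map `H²(X, ℱ) → H²(X, 𝒢)` induced by a morphism `ℱ ⟶ 𝒢` of `𝒪_X`-modules. -/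
noncomputable abbrev H2map {F G : X.Modules} (f : F ⟶ G) : H2 F →+ H2 G :=
  Sheaf.H.map ((SheafOfModules.toSheaf X.ringSheaf).map f) 2

/-- The module `H²(𝒰, ℱ)` of a cover `𝒰` of level `2`. -/
abbrev coverH2 (𝒰 : LevelTwoCover X.carrier) (F : X.Modules) : Type u :=
  𝒰.H2 (X.toPresheafModuleCat.obj F)

/-- The map `H²(𝒰, ℱ) → H²(𝒰, 𝒢)` induced by a morphism `ℱ ⟶ 𝒢` of `𝒪_X`-modules. -/
noncomputable abbrev coverH2map (𝒰 : LevelTwoCover X.carrier) {F G : X.Modules} (f : F ⟶ G) :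
    coverH2 𝒰 F →ₗ[X.GlobalSections] coverH2 𝒰 G :=
  𝒰.H2map (X.toPresheafModuleCat.map f)

/-- The map `H²(𝒰, ℱ) → H²(𝒰', ℱ)` induced by a refinement `𝒰'` of `𝒰`. -/
noncomputable abbrev coverH2refine {𝒰' 𝒰 : LevelTwoCover X.carrier} (r : 𝒰' ⟶ 𝒰) (F : X.Modules) :
    coverH2 𝒰 F →ₗ[X.GlobalSections] coverH2 𝒰' F :=
  LevelTwoCover.H2refine r (X.toPresheafModuleCat.obj F)

/-- Linear maps `H²(𝒰, ℱ) → H²(X, ℱ)` that are compatible with refinement form a cocone under the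
diagram of the modules `H²(𝒰, ℱ)`, with vertex `H²(X, ℱ)`. -/
noncomputable def cohomologyCocone (F : X.Modules)
    (Φ : ∀ 𝒰 : LevelTwoCover X.carrier, coverH2 𝒰 F →ₗ[X.GlobalSections] H2 F)
    (hΦ : ∀ (𝒰' 𝒰 : LevelTwoCover X.carrier) (r : 𝒰' ⟶ 𝒰) (x : coverH2 𝒰 F),
      Φ 𝒰' (coverH2refine r F x) = Φ 𝒰 x) :
    Limits.Cocone (LevelTwoCover.H2diagram (X.toPresheafModuleCat.obj F)) where
  pt := ModuleCat.of X.GlobalSections (H2 F)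
  ι :=
    { app := fun 𝒰 => ModuleCat.ofHom (Φ 𝒰.unop)
      naturality := fun 𝒰 𝒰' r => ModuleCat.hom_ext (LinearMap.ext fun x =>
        hΦ 𝒰'.unop 𝒰.unop r.unop x) }

end AlgebraicGeometry.RingedSpace

/-! ### Sections of abelian sheaves -/

/-! The proof is dimension shifting. Embed `F` in the sheaf `hull F` of discontinuous sections of
injective hulls of its stalks, with quotient `Q = cosyzygy F`, and embed `Q` in the same way, with
quotient `Q'`. Since both hulls are injective, `Q'(X) → H¹(X, Q)` is onto, its kernel is the image
of the global sections of `hull Q`, and `H¹(X, Q) → H²(X, F)` is bijective.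

On any cover of level 2, cochains of discontinuous sections are exact in degrees 1 and 2, by a
contraction chosen point by point (`exists_abd0_eq_of_pi`, `exists_abd1_eq_of_pi`). So a 2-cocycle
of `F` bounds in `hull F`; its primitive maps to a 1-cocycle of `Q`, which bounds in `hull Q`; that
primitive maps to a 0-cochain of `Q'` which glues to a global section. Applying the two connecting
maps to this section gives the class of the cocycle (`class₁`, `class₂`). The choices do not matter,
and naturality in `F` and under refinement is checked on representatives.

Every class occurs (`exists_class₂_eq`): a section of `Q'` lifts to `hull Q` on each member of some
open cover. Differences of lifts are sections of `Q` on the pairwise intersections, and these lift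
to `hull F` only locally. The second layer of the cover is exactly what makes room for these local
lifts.

A cocycle with zero class dies on a refinement (`exists_refine_eq_abd1_of_class₂_eq_zero`): its
1-cocycle in `Q` is already the coboundary of a 0-cochain. That cochain lifts to `hull F` once the
first layer is refined, and the lift corrects the primitive to one with values in `F`.

These two facts and the existence of common refinements give the colimit
(`ModuleCat.nonempty_isColimit_of_codirected`). The ordered version follows because forgetting the
orders is an initial functor (`forgetOrder_initial`). -/

/-- Sheaves of abelian groups on a topological space. -/
abbrev AbSheaf (X : TopCat.{u}) : Type (u + 1) :=
  Sheaf (Opens.grothendieckTopology X) AddCommGrpCat.{u}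

namespace AbSheaf

variable {X : TopCat.{u}}

/-- The group of sections of an abelian sheaf over an open set. -/
abbrev sec (F : AbSheaf X) (U : Opens X) : Type u := F.obj.obj (op U)

/-- Restriction of sections. -/
noncomputable def res (F : AbSheaf X) {U V : Opens X} (h : U ≤ V) : F.sec V →+ F.sec U :=
  (F.obj.map (homOfLE h).op).hom

/-- The map on sections induced by a morphism of sheaves. -/
noncomputable def app {F G : AbSheaf X} (f : F ⟶ G) (U : Opens X) : F.sec U →+ G.sec U :=
  (f.hom.app (op U)).hom

theorem res_res (F : AbSheaf X) {U V W : Opens X} (h : U ≤ V) (h' : V ≤ W) (x : F.sec W) :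
    F.res h (F.res h' x) = F.res (h.trans h') x := by
  have e : (homOfLE (h.trans h')).op = (homOfLE h').op ≫ (homOfLE h).op := rfl
  simp only [res]
  rw [e, F.obj.map_comp]
  rfl

theorem app_res {F G : AbSheaf X} (f : F ⟶ G) {U V : Opens X} (h : U ≤ V) (x : F.sec V) :
    app f U (F.res h x) = G.res h (app f V x) :=
  NatTrans.naturality_apply f.hom (homOfLE h).op x

theorem app_comp {F G H : AbSheaf X} (f : F ⟶ G) (g : G ⟶ H) (U : Opens X) (x : F.sec U) :
    app (f ≫ g) U x = app g U (app f U x) :=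
  rfl

theorem app_injective {F G : AbSheaf X} (f : F ⟶ G) [Mono f] (U : Opens X) :
    Function.Injective (app f U) := by
  have : Mono (f.hom.app (op U)) := by
    have : Mono ((sheafToPresheaf _ _).map f) := inferInstance
    exact NatTrans.mono_iff_mono_app _ |>.1 this _
  exact (AddCommGrpCat.mono_iff_injective _).1 this

theorem exists_lift_of_app_eq_zero {S : ShortComplex (AbSheaf X)} (hS : S.ShortExact)
    {U : Opens X} (s : S.X₂.sec U) (h : app S.g U s = 0) : ∃ t, app S.f U t = s :=
  TopCat.Sheaf.sections_exact_of_left_exact hS.1 hS.2 s h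

theorem exists_local_lift {F G : AbSheaf X} (f : F ⟶ G) [Epi f] {U : Opens X} (s : G.sec U)
    {x : X} (hx : x ∈ U) :
    ∃ (V : Opens X) (hV : V ≤ U), x ∈ V ∧ ∃ t, app f V t = G.res hV s := by
  have h : TopCat.Presheaf.IsLocallySurjective f.hom :=
    (TopCat.Sheaf.isLocallySurjective_iff_epi (F := F) (G := G) f).2 ‹Epi f›
  obtain ⟨V, hV, ⟨t, ht⟩, hx⟩ := (TopCat.Presheaf.isLocallySurjective_iff f.hom).1 h U s x hx
  exact ⟨V, hV, hx, t, ht⟩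

theorem sec_ext (F : AbSheaf X) {ι : Type*} (U : ι → Opens X) {V : Opens X} (hU : ∀ i, U i ≤ V)
    (hV : V ≤ ⨆ i, U i) {s t : F.sec V} (h : ∀ i, F.res (hU i) s = F.res (hU i) t) : s = t :=
  TopCat.Sheaf.eq_of_locally_eq' F U V (fun i => homOfLE (hU i)) hV s t h

theorem exists_glue (F : AbSheaf X) {ι : Type*} (U : ι → Opens X) {V : Opens X}
    (hU : ∀ i, U i ≤ V) (hV : V ≤ ⨆ i, U i) (s : ∀ i, F.sec (U i))
    (h : ∀ i j, F.res (inf_le_left : U i ⊓ U j ≤ U i) (s i) =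
      F.res (inf_le_right : U i ⊓ U j ≤ U j) (s j)) :
    ∃ t : F.sec V, ∀ i, F.res (hU i) t = s i :=
  (TopCat.Sheaf.existsUnique_gluing' F U V (fun i => homOfLE (hU i)) hV s h).exists

/-! ### Sheaves of discontinuous sections -/

/-- The sheaf whose sections over `U` are the families of elements of `D x` for `x ∈ U`. -/
noncomputable def pi (D : X → AddCommGrpCat.{u}) : AbSheaf X where
  obj :=
    { obj := fun U => AddCommGrpCat.of (∀ x : U.unop, D x)
      map := fun {_ V} i => AddCommGrpCat.ofHom
        { toFun := fun g (x : V.unop) => g ⟨x.1, i.unop.le x.2⟩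
          map_zero' := rfl
          map_add' := fun _ _ => rfl } }
  property := (TopCat.Presheaf.isSheaf_iff_isSheaf_comp (forget AddCommGrpCat.{u}) _).2
    (TopCat.Presheaf.toTypes_isSheaf X fun x => D x)

/-- A family of homomorphisms from the stalks of `F` to the groups `D x` defines a morphism from
`F` to the sheaf of discontinuous sections of `D`. -/
noncomputable def toPi (F : AbSheaf X) (D : X → AddCommGrpCat.{u})
    (f : ∀ x, TopCat.Presheaf.stalk F.obj x ⟶ D x) : F ⟶ pi D where
  hom :=
    { app := fun U => AddCommGrpCat.ofHom (AddMonoidHom.mk'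
        (fun (s : F.sec U.unop) (x : U.unop) => f x (TopCat.Presheaf.germ F.obj U.unop x.1 x.2 s))
        (fun s t => by
          funext x
          simp only [map_add]
          rfl))
      naturality := fun U V i => by
        ext s
        funext x
        change f x _ = f x _
        exact congrArg (f x) (TopCat.Presheaf.germ_res_apply F.obj i.unop x.1 x.2 s) }

theorem toPi_apply (F : AbSheaf X) (D : X → AddCommGrpCat.{u})
    (f : ∀ x, TopCat.Presheaf.stalk F.obj x ⟶ D x) (U : Opens X) (s : F.sec U) (x : U) :
    (app (toPi F D f) U s : ∀ x : U, D x) x = f x (TopCat.Presheaf.germ F.obj U x.1 x.2 s) :=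
  rfl

/-- The homomorphism from a stalk given by a morphism to a sheaf of discontinuous sections. -/
noncomputable def stalkOfToPi (F : AbSheaf X) (D : X → AddCommGrpCat.{u}) (f : F ⟶ pi D) (x : X) :
    TopCat.Presheaf.stalk F.obj x ⟶ D x :=
  Limits.colimit.desc ((OpenNhds.inclusion x).op ⋙ F.obj)
    (Limits.Cocone.mk (D x)
      { app := fun U => f.hom.app (op U.unop.1) ≫ AddCommGrpCat.ofHom
            (Pi.evalAddMonoidHom (fun y : U.unop.1 => (D y : Type u)) ⟨x, U.unop.property⟩)
        naturality := fun _ V i => AddCommGrpCat.ext fun s =>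
          congrFun (NatTrans.naturality_apply f.hom ((OpenNhds.inclusion x).op.map i) s)
            ⟨x, V.unop.property⟩ })

theorem stalkOfToPi_germ (F : AbSheaf X) (D : X → AddCommGrpCat.{u}) (f : F ⟶ pi D) (U : Opens X)
    (x : X) (hx : x ∈ U) (s : F.sec U) :
    stalkOfToPi F D f x (TopCat.Presheaf.germ F.obj U x hx s) =
      (app f U s : ∀ x : U, D x) ⟨x, hx⟩ := by
  have h : TopCat.Presheaf.germ F.obj U x hx ≫ stalkOfToPi F D f x =
      f.hom.app (op U) ≫ AddCommGrpCat.ofHom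
        (Pi.evalAddMonoidHom (fun y : U => (D y : Type u)) ⟨x, hx⟩) :=
    Limits.colimit.ι_desc (F := (OpenNhds.inclusion x).op ⋙ F.obj) _ (op ⟨U, hx⟩)
  exact ConcreteCategory.congr_hom h s

/-- The map on stalks induced by a morphism of sheaves. -/
noncomputable def stalkMap {F G : AbSheaf X} (f : F ⟶ G) (x : X) :
    TopCat.Presheaf.stalk F.obj x ⟶ TopCat.Presheaf.stalk G.obj x :=
  (TopCat.Presheaf.stalkFunctor AddCommGrpCat.{u} x).map f.hom

theorem stalkMap_germ {F G : AbSheaf X} (f : F ⟶ G) {U : Opens X} {x : X} (hx : x ∈ U)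
    (s : F.sec U) :
    stalkMap f x (TopCat.Presheaf.germ F.obj U x hx s) =
      TopCat.Presheaf.germ G.obj U x hx (app f U s) :=
  TopCat.Presheaf.stalkFunctor_map_germ_apply U x hx f.hom s

instance {F G : AbSheaf X} (f : F ⟶ G) [Mono f] (x : X) : Mono (stalkMap f x) :=
  @TopCat.Presheaf.stalk_mono_of_mono _ _ _ _ _ _ _ _ _ _ _ _ F G f ‹Mono f› x

theorem hom_pi_ext {F : AbSheaf X} {D : X → AddCommGrpCat.{u}} {f g : F ⟶ pi D}
    (h : ∀ (U : Opens X) (s : F.sec U) (x : U),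
      (app f U s : ∀ x : U, D x) x = (app g U s : ∀ x : U, D x) x) : f = g := by
  ext U s
  exact funext fun x => h U.unop s x

/-- A morphism to `pi D` amounts to a family of homomorphisms from the stalks to the groups `D x`. A
monomorphism of sheaves is injective on stalks, so the family extends one point at a time. -/
instance pi_injective (D : X → AddCommGrpCat.{u}) [∀ x, Injective (D x)] : Injective (pi D) where
  factors {A B} g i _ := by
    refine ⟨toPi B D fun x => Injective.factorThru (stalkOfToPi A D g x) (stalkMap i x),
      hom_pi_ext fun U s x => ?_⟩
    rw [app_comp, toPi_apply, ← stalkMap_germ, ← stalkOfToPi_germ]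
    exact ConcreteCategory.congr_hom
      (Injective.comp_factorThru (stalkOfToPi A D g x.1) (stalkMap i x.1)) _

/-! ### The canonical embedding into an injective sheaf -/

variable (F : AbSheaf X)

/-- Injective hulls of the stalks of a sheaf. -/
noncomputable abbrev stalkHull (x : X) : AddCommGrpCat.{u} :=
  Injective.under (TopCat.Presheaf.stalk F.obj x)

/-- An injective sheaf of discontinuous sections that contains `F`. -/
noncomputable abbrev hull : AbSheaf X := pi F.stalkHull

/-- The embedding of `F` into an injective sheaf. -/
noncomputable def toHull : F ⟶ F.hull := toPi F F.stalkHull fun _ => Injective.ι _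

/-- A section is determined by its germs, and each stalk embeds in its hull. -/
instance : Mono F.toHull := by
  have (U : (Opens X)ᵒᵖ) : Mono (F.toHull.hom.app U) := by
    rw [AddCommGrpCat.mono_iff_injective]
    intro s t h
    refine TopCat.Presheaf.section_ext F U.unop s t fun x hx => ?_
    exact (AddCommGrpCat.mono_iff_injective (Injective.ι _)).1 inferInstance
      (congrFun h (⟨x, hx⟩ : U.unop))
  have : Mono F.toHull.hom := NatTrans.mono_of_mono_app _
  exact (sheafToPresheaf _ _).mono_of_mono_map this

/-- The quotient of the injective sheaf `hull F` by `F`. -/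
noncomputable def cosyzygy : AbSheaf X := Limits.cokernel F.toHull

/-- The projection from `hull F` to its quotient by `F`. -/
noncomputable def hullProj : F.hull ⟶ F.cosyzygy := Limits.cokernel.π F.toHull

instance : Epi F.hullProj := inferInstanceAs (Epi (Limits.cokernel.π F.toHull))

theorem toHull_comp_hullProj : F.toHull ≫ F.hullProj = 0 := Limits.cokernel.condition _

/-- The short complex `F ⟶ hull F ⟶ hull F / F`. -/
noncomputable abbrev hullComplex : ShortComplex (AbSheaf X) :=
  ShortComplex.mk F.toHull F.hullProj F.toHull_comp_hullProj

theorem hullComplex_shortExact : F.hullComplex.ShortExact where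
  exact := ShortComplex.exact_cokernel F.toHull

variable {F}

theorem hullProj_toHull {U : Opens X} (s : F.sec U) :
    app F.hullProj U (app F.toHull U s) = 0 :=
  congrArg (fun f => app f U s) F.toHull_comp_hullProj

theorem exists_toHull_eq {U : Opens X} (s : F.hull.sec U) (h : app F.hullProj U s = 0) :
    ∃ t, app F.toHull U t = s :=
  exists_lift_of_app_eq_zero F.hullComplex_shortExact s h

/-- Injectivity of `hull G` extends `f` to the hulls, and the cokernel property induces the map on
quotients. Although `hull` is not used as a functor, this suffices for naturality of the classes. -/
theorem exists_hullComplex_map {G : AbSheaf X} (f : F ⟶ G) :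
    ∃ φ : F.hullComplex ⟶ G.hullComplex, φ.τ₁ = f := by
  have h : F.toHull ≫ Injective.factorThru (f ≫ G.toHull) F.toHull = f ≫ G.toHull :=
    Injective.comp_factorThru _ _
  have h' : F.toHull ≫ Injective.factorThru (f ≫ G.toHull) F.toHull ≫ G.hullProj = 0 := by
    rw [← Category.assoc, h, Category.assoc, toHull_comp_hullProj, Limits.comp_zero]
  exact ⟨{ τ₁ := f
           τ₂ := Injective.factorThru (f ≫ G.toHull) F.toHull
           τ₃ := F.hullComplex_shortExact.exact.desc
            (k := Injective.factorThru (f ≫ G.toHull) F.toHull ≫ G.hullProj) h'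
           comm₁₂ := h.symm
           comm₂₃ := (F.hullComplex_shortExact.exact.g_desc _ _).symm }, rfl⟩

/-! ### Connecting homomorphisms -/

section Connecting

variable {S : ShortComplex (AbSheaf X)} (hS : S.ShortExact)

/-- The connecting homomorphism from global sections to `H¹`. -/
noncomputable def connecting₀ : S.X₃.sec ⊤ →+ Sheaf.H S.X₁ 1 :=
  (hS.extClass.postcomp _ (zero_add 1)).comp
    (Sheaf.H.equiv₀ S.X₃ Limits.isTerminalTop).symm.toAddMonoidHom

/-- The connecting homomorphism from `H¹` to `H²`. -/
noncomputable def connecting₁ : Sheaf.H S.X₃ 1 →+ Sheaf.H S.X₁ 2 :=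
  hS.extClass.postcomp _ rfl

theorem connecting₀_apply (s : S.X₃.sec ⊤) :
    connecting₀ hS s = ((Sheaf.H.equiv₀ S.X₃ Limits.isTerminalTop).symm s).comp
      hS.extClass (zero_add 1) :=
  rfl

theorem connecting₁_apply (y : Sheaf.H S.X₃ 1) :
    connecting₁ hS y = y.comp hS.extClass rfl :=
  rfl

/-- The obstruction lies in `H¹` of the middle term, which vanishes by injectivity. -/
theorem connecting₀_surjective [Injective S.X₂] : Function.Surjective (connecting₀ hS) := by
  intro y
  obtain ⟨z, hz⟩ := Abelian.Ext.covariant_sequence_exact₁ _ hS y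
    (Abelian.Ext.eq_zero_of_injective _) (zero_add 1)
  refine ⟨Sheaf.H.equiv₀ S.X₃ Limits.isTerminalTop z, ?_⟩
  rw [connecting₀_apply, AddEquiv.symm_apply_apply]
  exact hz

theorem connecting₀_app (t : S.X₂.sec ⊤) : connecting₀ hS (app S.g ⊤ t) = 0 := by
  have h := Sheaf.H.equiv₀_symm_naturality Limits.isTerminalTop S.g t
  have h' : connecting₀ hS (app S.g ⊤ t) =
      (Sheaf.H.map S.g 0 ((Sheaf.H.equiv₀ S.X₂ Limits.isTerminalTop).symm t)).comp
        hS.extClass (zero_add 1) := by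
    rw [h]
    rfl
  rw [h', Sheaf.H.map_apply, Abelian.Ext.comp_assoc_of_second_deg_zero, hS.comp_extClass,
    Abelian.Ext.comp_zero]

theorem exists_of_connecting₀_eq_zero {s : S.X₃.sec ⊤} (hs : connecting₀ hS s = 0) :
    ∃ t, app S.g ⊤ t = s := by
  obtain ⟨z, hz⟩ := Abelian.Ext.covariant_sequence_exact₃ _ hS _ (zero_add 1) hs
  refine ⟨Sheaf.H.equiv₀ S.X₂ Limits.isTerminalTop z, ?_⟩
  refine (Sheaf.H.equiv₀_naturality Limits.isTerminalTop S.g z).trans ?_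
  exact (congrArg (Sheaf.H.equiv₀ S.X₃ Limits.isTerminalTop) hz).trans
    (AddEquiv.apply_symm_apply _ _)

theorem connecting₁_surjective [Injective S.X₂] : Function.Surjective (connecting₁ hS) := fun y =>
  Abelian.Ext.covariant_sequence_exact₁ _ hS y (Abelian.Ext.eq_zero_of_injective _) rfl

/-- The kernel is the image of `H¹` of the injective middle term, which is zero. -/
theorem connecting₁_injective [Injective S.X₂] : Function.Injective (connecting₁ hS) := by
  rw [injective_iff_map_eq_zero]
  intro y hy
  obtain ⟨z, rfl⟩ := Abelian.Ext.covariant_sequence_exact₃ _ hS y rfl hy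
  rw [Abelian.Ext.eq_zero_of_injective z, Abelian.Ext.zero_comp]

variable {T : ShortComplex (AbSheaf X)} (hT : T.ShortExact) (φ : S ⟶ T)

theorem map_connecting₀ (s : S.X₃.sec ⊤) :
    Sheaf.H.map φ.τ₁ 1 (connecting₀ hS s) = connecting₀ hT (app φ.τ₃ ⊤ s) := by
  have h := Sheaf.H.equiv₀_symm_naturality Limits.isTerminalTop φ.τ₃ s
  have h' : connecting₀ hT (app φ.τ₃ ⊤ s) =
      (Sheaf.H.map φ.τ₃ 0 ((Sheaf.H.equiv₀ S.X₃ Limits.isTerminalTop).symm s)).comp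
        hT.extClass (zero_add 1) := by
    rw [h]
    rfl
  rw [h', connecting₀_apply, Sheaf.H.map_apply, Sheaf.H.map_apply,
    Abelian.Ext.comp_assoc_of_second_deg_zero, Abelian.Ext.comp_assoc_of_third_deg_zero,
    ShortComplex.ShortExact.extClass_naturality hS hT φ]

theorem map_connecting₁ (y : Sheaf.H S.X₃ 1) :
    Sheaf.H.map φ.τ₁ 2 (connecting₁ hS y) = connecting₁ hT (Sheaf.H.map φ.τ₃ 1 y) := by
  rw [connecting₁_apply, connecting₁_apply, Sheaf.H.map_apply, Sheaf.H.map_apply,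
    Abelian.Ext.comp_assoc_of_second_deg_zero, Abelian.Ext.comp_assoc_of_third_deg_zero,
    ShortComplex.ShortExact.extClass_naturality hS hT φ]

end Connecting

end AbSheaf

/-! ### Cochains with values in abelian sheaves -/

namespace LevelTwoCover

open AbSheaf

variable {X : TopCat.{u}} (𝒰 : LevelTwoCover X)

theorem V_le_inf {i₀ i₁ : 𝒰.I} (j : 𝒰.J s(i₀, i₁)) : 𝒰.V _ j ≤ 𝒰.U i₀ ⊓ 𝒰.U i₁ :=
  (le_iSup (fun j => 𝒰.V s(i₀, i₁) j) j).trans (𝒰.iSup_V i₀ i₁).le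

theorem V_le_left {i₀ i₁ : 𝒰.I} (j : 𝒰.J s(i₀, i₁)) : 𝒰.V _ j ≤ 𝒰.U i₀ :=
  (𝒰.V_le_inf j).trans inf_le_left

theorem V_le_right {i₀ i₁ : 𝒰.I} (j : 𝒰.J s(i₀, i₁)) : 𝒰.V _ j ≤ 𝒰.U i₁ :=
  (𝒰.V_le_inf j).trans inf_le_right

theorem exists_mem_U (x : X) : ∃ i, x ∈ 𝒰.U i :=
  Opens.mem_iSup.1 (𝒰.iSup_U ▸ Opens.mem_top x)

theorem exists_mem_V {x : X} {i₀ i₁ : 𝒰.I} (h₀ : x ∈ 𝒰.U i₀) (h₁ : x ∈ 𝒰.U i₁) :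
    ∃ j : 𝒰.J s(i₀, i₁), x ∈ 𝒰.V _ j :=
  Opens.mem_iSup.1 ((𝒰.iSup_V i₀ i₁).ge ⟨h₀, h₁⟩)

/-- The `0`-cochains of an abelian sheaf. -/
abbrev AbC0 (F : AbSheaf X) : Type u := (i : 𝒰.I) → F.sec (𝒰.U i)

/-- The `1`-cochains of an abelian sheaf. -/
abbrev AbC1 (F : AbSheaf X) : Type u := (i₀ i₁ : 𝒰.I) → (j : 𝒰.J s(i₀, i₁)) → F.sec (𝒰.V _ j)

/-- The `2`-cochains of an abelian sheaf. -/
abbrev AbC2 (F : AbSheaf X) : Type u :=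
  (i₀ i₁ i₂ : 𝒰.I) → (j₁₂ : 𝒰.J s(i₁, i₂)) → (j₀₂ : 𝒰.J s(i₀, i₂)) → (j₀₁ : 𝒰.J s(i₀, i₁)) →
    F.sec (𝒰.inter₃ j₁₂ j₀₂ j₀₁)

/-- The `3`-cochains of an abelian sheaf. -/
abbrev AbC3 (F : AbSheaf X) : Type u :=
  (i₀ i₁ i₂ i₃ : 𝒰.I) → (j₂₃ : 𝒰.J s(i₂, i₃)) → (j₁₃ : 𝒰.J s(i₁, i₃)) →
    (j₁₂ : 𝒰.J s(i₁, i₂)) → (j₀₃ : 𝒰.J s(i₀, i₃)) → (j₀₂ : 𝒰.J s(i₀, i₂)) →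
    (j₀₁ : 𝒰.J s(i₀, i₁)) → F.sec (𝒰.inter₆ j₂₃ j₁₃ j₁₂ j₀₃ j₀₂ j₀₁)

/-- The differential from `0`-cochains to `1`-cochains. -/
noncomputable def abd0 (F : AbSheaf X) : 𝒰.AbC0 F →+ 𝒰.AbC1 F :=
  AddMonoidHom.mk' (fun τ i₀ i₁ j =>
    F.res (𝒰.V_le_right j) (τ i₁) - F.res (𝒰.V_le_left j) (τ i₀)) fun τ τ' => by
      funext i₀ i₁ j
      simp only [Pi.add_apply, map_add]
      abel

/-- The differential from `1`-cochains to `2`-cochains. -/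
noncomputable def abd1 (F : AbSheaf X) : 𝒰.AbC1 F →+ 𝒰.AbC2 F :=
  AddMonoidHom.mk' (fun σ i₀ i₁ i₂ j₁₂ j₀₂ j₀₁ =>
    F.res (inter₃_le₁₂ j₁₂ j₀₂ j₀₁) (σ i₁ i₂ j₁₂)
      - F.res (inter₃_le₀₂ j₁₂ j₀₂ j₀₁) (σ i₀ i₂ j₀₂)
      + F.res (inter₃_le₀₁ j₁₂ j₀₂ j₀₁) (σ i₀ i₁ j₀₁)) fun σ σ' => by
      funext i₀ i₁ i₂ j₁₂ j₀₂ j₀₁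
      simp only [Pi.add_apply, map_add]
      abel

/-- The differential from `2`-cochains to `3`-cochains. -/
noncomputable def abd2 (F : AbSheaf X) : 𝒰.AbC2 F →+ 𝒰.AbC3 F :=
  AddMonoidHom.mk' (fun ρ i₀ i₁ i₂ i₃ j₂₃ j₁₃ j₁₂ j₀₃ j₀₂ j₀₁ =>
    F.res (inter₆_le₁₂₃ j₂₃ j₁₃ j₁₂ j₀₃ j₀₂ j₀₁) (ρ i₁ i₂ i₃ j₂₃ j₁₃ j₁₂)
      - F.res (inter₆_le₀₂₃ j₂₃ j₁₃ j₁₂ j₀₃ j₀₂ j₀₁) (ρ i₀ i₂ i₃ j₂₃ j₀₃ j₀₂)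
      + F.res (inter₆_le₀₁₃ j₂₃ j₁₃ j₁₂ j₀₃ j₀₂ j₀₁) (ρ i₀ i₁ i₃ j₁₃ j₀₃ j₀₁)
      - F.res (inter₆_le₀₁₂ j₂₃ j₁₃ j₁₂ j₀₃ j₀₂ j₀₁) (ρ i₀ i₁ i₂ j₁₂ j₀₂ j₀₁)) fun ρ ρ' => by
      funext i₀ i₁ i₂ i₃ j₂₃ j₁₃ j₁₂ j₀₃ j₀₂ j₀₁
      simp only [Pi.add_apply, map_add]
      abel

variable {𝒰} {F G : AbSheaf X}

theorem abd0_apply (τ : 𝒰.AbC0 F) {i₀ i₁ : 𝒰.I} (j : 𝒰.J s(i₀, i₁)) :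
    𝒰.abd0 F τ i₀ i₁ j = F.res (𝒰.V_le_right j) (τ i₁) - F.res (𝒰.V_le_left j) (τ i₀) :=
  rfl

theorem abd1_apply (σ : 𝒰.AbC1 F) {i₀ i₁ i₂ : 𝒰.I} (j₁₂ : 𝒰.J s(i₁, i₂)) (j₀₂ : 𝒰.J s(i₀, i₂))
    (j₀₁ : 𝒰.J s(i₀, i₁)) :
    𝒰.abd1 F σ i₀ i₁ i₂ j₁₂ j₀₂ j₀₁ = F.res (inter₃_le₁₂ j₁₂ j₀₂ j₀₁) (σ i₁ i₂ j₁₂)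
      - F.res (inter₃_le₀₂ j₁₂ j₀₂ j₀₁) (σ i₀ i₂ j₀₂)
      + F.res (inter₃_le₀₁ j₁₂ j₀₂ j₀₁) (σ i₀ i₁ j₀₁) :=
  rfl

theorem abd2_apply (ρ : 𝒰.AbC2 F) {i₀ i₁ i₂ i₃ : 𝒰.I} (j₂₃ : 𝒰.J s(i₂, i₃))
    (j₁₃ : 𝒰.J s(i₁, i₃)) (j₁₂ : 𝒰.J s(i₁, i₂)) (j₀₃ : 𝒰.J s(i₀, i₃)) (j₀₂ : 𝒰.J s(i₀, i₂))
    (j₀₁ : 𝒰.J s(i₀, i₁)) :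
    𝒰.abd2 F ρ i₀ i₁ i₂ i₃ j₂₃ j₁₃ j₁₂ j₀₃ j₀₂ j₀₁ =
    F.res (inter₆_le₁₂₃ j₂₃ j₁₃ j₁₂ j₀₃ j₀₂ j₀₁) (ρ i₁ i₂ i₃ j₂₃ j₁₃ j₁₂)
      - F.res (inter₆_le₀₂₃ j₂₃ j₁₃ j₁₂ j₀₃ j₀₂ j₀₁) (ρ i₀ i₂ i₃ j₂₃ j₀₃ j₀₂)
      + F.res (inter₆_le₀₁₃ j₂₃ j₁₃ j₁₂ j₀₃ j₀₂ j₀₁) (ρ i₀ i₁ i₃ j₁₃ j₀₃ j₀₁)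
      - F.res (inter₆_le₀₁₂ j₂₃ j₁₃ j₁₂ j₀₃ j₀₂ j₀₁) (ρ i₀ i₁ i₂ j₁₂ j₀₂ j₀₁) :=
  rfl

theorem abd1_abd0 (τ : 𝒰.AbC0 F) : 𝒰.abd1 F (𝒰.abd0 F τ) = 0 := by
  funext i₀ i₁ i₂ j₁₂ j₀₂ j₀₁
  simp only [abd1_apply, abd0_apply, map_sub, AbSheaf.res_res, Pi.zero_apply]
  abel

theorem abd2_abd1 (σ : 𝒰.AbC1 F) : 𝒰.abd2 F (𝒰.abd1 F σ) = 0 := by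
  funext i₀ i₁ i₂ i₃ j₂₃ j₁₃ j₁₂ j₀₃ j₀₂ j₀₁
  simp only [abd1_apply, abd2_apply, map_add, map_sub, AbSheaf.res_res, Pi.zero_apply]
  abel

/-! ### Functoriality in the sheaf -/

variable (𝒰) in
/-- The map on `0`-cochains induced by a morphism of sheaves. -/
noncomputable def mapC0 (f : F ⟶ G) : 𝒰.AbC0 F →+ 𝒰.AbC0 G :=
  AddMonoidHom.mk' (fun τ i => app f _ (τ i)) fun τ τ' => by
    funext i
    simp only [Pi.add_apply, map_add]

variable (𝒰) in
/-- The map on `1`-cochains induced by a morphism of sheaves. -/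
noncomputable def mapC1 (f : F ⟶ G) : 𝒰.AbC1 F →+ 𝒰.AbC1 G :=
  AddMonoidHom.mk' (fun σ i₀ i₁ j => app f _ (σ i₀ i₁ j)) fun σ σ' => by
    funext i₀ i₁ j
    simp only [Pi.add_apply, map_add]

variable (𝒰) in
/-- The map on `2`-cochains induced by a morphism of sheaves. -/
noncomputable def mapC2 (f : F ⟶ G) : 𝒰.AbC2 F →+ 𝒰.AbC2 G :=
  AddMonoidHom.mk' (fun ρ i₀ i₁ i₂ j₁₂ j₀₂ j₀₁ => app f _ (ρ i₀ i₁ i₂ j₁₂ j₀₂ j₀₁)) fun ρ ρ' => by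
    funext i₀ i₁ i₂ j₁₂ j₀₂ j₀₁
    simp only [Pi.add_apply, map_add]

theorem mapC0_apply (f : F ⟶ G) (τ : 𝒰.AbC0 F) (i : 𝒰.I) : 𝒰.mapC0 f τ i = app f _ (τ i) :=
  rfl

theorem mapC1_apply (f : F ⟶ G) (σ : 𝒰.AbC1 F) {i₀ i₁ : 𝒰.I} (j : 𝒰.J s(i₀, i₁)) :
    𝒰.mapC1 f σ i₀ i₁ j = app f _ (σ i₀ i₁ j) :=
  rfl

theorem mapC2_apply (f : F ⟶ G) (ρ : 𝒰.AbC2 F) {i₀ i₁ i₂ : 𝒰.I} (j₁₂ : 𝒰.J s(i₁, i₂))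
    (j₀₂ : 𝒰.J s(i₀, i₂)) (j₀₁ : 𝒰.J s(i₀, i₁)) :
    𝒰.mapC2 f ρ i₀ i₁ i₂ j₁₂ j₀₂ j₀₁ = app f _ (ρ i₀ i₁ i₂ j₁₂ j₀₂ j₀₁) :=
  rfl

theorem abd0_mapC0 (f : F ⟶ G) (τ : 𝒰.AbC0 F) :
    𝒰.abd0 G (𝒰.mapC0 f τ) = 𝒰.mapC1 f (𝒰.abd0 F τ) := by
  funext i₀ i₁ j
  simp only [abd0_apply, mapC0_apply, mapC1_apply, map_sub, app_res]

theorem abd1_mapC1 (f : F ⟶ G) (σ : 𝒰.AbC1 F) :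
    𝒰.abd1 G (𝒰.mapC1 f σ) = 𝒰.mapC2 f (𝒰.abd1 F σ) := by
  funext i₀ i₁ i₂ j₁₂ j₀₂ j₀₁
  simp only [abd1_apply, mapC1_apply, mapC2_apply, map_sub, map_add, app_res]

theorem abd2_mapC2 (f : F ⟶ G) {ρ : 𝒰.AbC2 F} (hρ : 𝒰.abd2 F ρ = 0) :
    𝒰.abd2 G (𝒰.mapC2 f ρ) = 0 := by
  funext i₀ i₁ i₂ i₃ j₂₃ j₁₃ j₁₂ j₀₃ j₀₂ j₀₁
  have h := congrArg (fun c => app f _ (c i₀ i₁ i₂ i₃ j₂₃ j₁₃ j₁₂ j₀₃ j₀₂ j₀₁)) hρ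
  simpa only [abd2_apply, mapC2_apply, map_sub, map_add, app_res, Pi.zero_apply, map_zero] using h

theorem mapC1_injective (f : F ⟶ G) [Mono f] : Function.Injective (𝒰.mapC1 f) := fun σ σ' h => by
  funext i₀ i₁ j
  exact app_injective f _ (congrFun (congrFun (congrFun h i₀) i₁) j)

theorem mapC2_injective (f : F ⟶ G) [Mono f] : Function.Injective (𝒰.mapC2 f) := fun ρ ρ' h => by
  funext i₀ i₁ i₂ j₁₂ j₀₂ j₀₁
  exact app_injective f _ (congrFun (congrFun (congrFun (congrFun (congrFun (congrFun h
    i₀) i₁) i₂) j₁₂) j₀₂) j₀₁)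

theorem abd2_eq_zero_of_mapC2 (f : F ⟶ G) [Mono f] {ρ : 𝒰.AbC2 F}
    (hρ : 𝒰.abd2 G (𝒰.mapC2 f ρ) = 0) : 𝒰.abd2 F ρ = 0 := by
  funext i₀ i₁ i₂ i₃ j₂₃ j₁₃ j₁₂ j₀₃ j₀₂ j₀₁
  refine app_injective f _ ?_
  have h := congrArg (fun c => c i₀ i₁ i₂ i₃ j₂₃ j₁₃ j₁₂ j₀₃ j₀₂ j₀₁) hρ
  simpa only [abd2_apply, mapC2_apply, map_sub, map_add, app_res, Pi.zero_apply, map_zero] using h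

theorem mapC1_comp {H : AbSheaf X} (f : F ⟶ G) (g : G ⟶ H) (σ : 𝒰.AbC1 F) :
    𝒰.mapC1 (f ≫ g) σ = 𝒰.mapC1 g (𝒰.mapC1 f σ) :=
  rfl

theorem mapC2_comp {H : AbSheaf X} (f : F ⟶ G) (g : G ⟶ H) (ρ : 𝒰.AbC2 F) :
    𝒰.mapC2 (f ≫ g) ρ = 𝒰.mapC2 g (𝒰.mapC2 f ρ) :=
  rfl

theorem exists_mapC0_toHull_eq {τ : 𝒰.AbC0 F.hull} (h : 𝒰.mapC0 F.hullProj τ = 0) :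
    ∃ φ, 𝒰.mapC0 F.toHull φ = τ := by
  choose φ hφ using fun i => exists_toHull_eq (τ i) (congrFun h i)
  exact ⟨φ, funext hφ⟩

theorem exists_mapC1_toHull_eq {σ : 𝒰.AbC1 F.hull} (h : 𝒰.mapC1 F.hullProj σ = 0) :
    ∃ φ, 𝒰.mapC1 F.toHull φ = σ := by
  choose φ hφ using fun i₀ i₁ j =>
    exists_toHull_eq (σ i₀ i₁ j) (congrFun (congrFun (congrFun h i₀) i₁) j)
  exact ⟨φ, funext fun i₀ => funext fun i₁ => funext fun j => hφ i₀ i₁ j⟩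

theorem exists_mapC2_toHull_eq {ρ : 𝒰.AbC2 F.hull} (h : 𝒰.mapC2 F.hullProj ρ = 0) :
    ∃ φ, 𝒰.mapC2 F.toHull φ = ρ := by
  choose φ hφ using fun i₀ i₁ i₂ j₁₂ j₀₂ j₀₁ => exists_toHull_eq (ρ i₀ i₁ i₂ j₁₂ j₀₂ j₀₁)
    (congrFun (congrFun (congrFun (congrFun (congrFun (congrFun h i₀) i₁) i₂) j₁₂) j₀₂) j₀₁)
  exact ⟨φ, funext fun i₀ => funext fun i₁ => funext fun i₂ => funext fun j₁₂ => funext fun j₀₂ =>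
    funext fun j₀₁ => hφ i₀ i₁ i₂ j₁₂ j₀₂ j₀₁⟩

theorem mapC1_hullProj_toHull (σ : 𝒰.AbC1 F) :
    𝒰.mapC1 F.hullProj (𝒰.mapC1 F.toHull σ) = 0 := by
  funext i₀ i₁ j
  exact hullProj_toHull _

theorem mapC2_hullProj_toHull (ρ : 𝒰.AbC2 F) :
    𝒰.mapC2 F.hullProj (𝒰.mapC2 F.toHull ρ) = 0 := by
  funext i₀ i₁ i₂ j₁₂ j₀₂ j₀₁
  exact hullProj_toHull _

/-! ### Restriction to refinements -/

section Refine

variable {𝒰' 𝒰 : LevelTwoCover X} (r : 𝒰' ⟶ 𝒰)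

/-- The map on `0`-cochains induced by a refinement. -/
noncomputable def refineC0 (F : AbSheaf X) : 𝒰.AbC0 F →+ 𝒰'.AbC0 F :=
  AddMonoidHom.mk' (fun τ i => F.res (r.U_le i) (τ (r.idx i))) fun τ τ' => by
    funext i
    simp only [Pi.add_apply, map_add]

/-- The map on `1`-cochains induced by a refinement. -/
noncomputable def refineC1 (F : AbSheaf X) : 𝒰.AbC1 F →+ 𝒰'.AbC1 F :=
  AddMonoidHom.mk' (fun σ i₀ i₁ j =>
    F.res (Refinement.V_le_idxJ r j) (σ (r.idx i₀) (r.idx i₁) (Refinement.idxJ r j))) fun σ σ' => by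
      funext i₀ i₁ j
      simp only [Pi.add_apply, map_add]

/-- The map on `2`-cochains induced by a refinement. -/
noncomputable def refineC2 (F : AbSheaf X) : 𝒰.AbC2 F →+ 𝒰'.AbC2 F :=
  AddMonoidHom.mk' (fun ρ i₀ i₁ i₂ j₁₂ j₀₂ j₀₁ => F.res (Refinement.inter₃_le r j₁₂ j₀₂ j₀₁)
      (ρ (r.idx i₀) (r.idx i₁) (r.idx i₂) (Refinement.idxJ r j₁₂) (Refinement.idxJ r j₀₂)
        (Refinement.idxJ r j₀₁))) fun ρ ρ' => by
    funext i₀ i₁ i₂ j₁₂ j₀₂ j₀₁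
    simp only [Pi.add_apply, map_add]

theorem refineC0_apply (τ : 𝒰.AbC0 F) (i : 𝒰'.I) :
    refineC0 r F τ i = F.res (r.U_le i) (τ (r.idx i)) :=
  rfl

theorem refineC1_apply (σ : 𝒰.AbC1 F) {i₀ i₁ : 𝒰'.I} (j : 𝒰'.J s(i₀, i₁)) :
    refineC1 r F σ i₀ i₁ j =
      F.res (Refinement.V_le_idxJ r j) (σ (r.idx i₀) (r.idx i₁) (Refinement.idxJ r j)) :=
  rfl

theorem refineC2_apply (ρ : 𝒰.AbC2 F) {i₀ i₁ i₂ : 𝒰'.I} (j₁₂ : 𝒰'.J s(i₁, i₂))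
    (j₀₂ : 𝒰'.J s(i₀, i₂)) (j₀₁ : 𝒰'.J s(i₀, i₁)) :
    refineC2 r F ρ i₀ i₁ i₂ j₁₂ j₀₂ j₀₁ = F.res (Refinement.inter₃_le r j₁₂ j₀₂ j₀₁)
      (ρ (r.idx i₀) (r.idx i₁) (r.idx i₂) (Refinement.idxJ r j₁₂) (Refinement.idxJ r j₀₂)
        (Refinement.idxJ r j₀₁)) :=
  rfl

theorem abd0_refineC0 (τ : 𝒰.AbC0 F) :
    𝒰'.abd0 F (refineC0 r F τ) = refineC1 r F (𝒰.abd0 F τ) := by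
  funext i₀ i₁ j
  simp only [abd0_apply, refineC0_apply, refineC1_apply, map_sub, AbSheaf.res_res]

theorem abd1_refineC1 (σ : 𝒰.AbC1 F) :
    𝒰'.abd1 F (refineC1 r F σ) = refineC2 r F (𝒰.abd1 F σ) := by
  funext i₀ i₁ i₂ j₁₂ j₀₂ j₀₁
  simp only [abd1_apply, refineC1_apply, refineC2_apply, map_sub, map_add, AbSheaf.res_res]

theorem abd2_refineC2 {ρ : 𝒰.AbC2 F} (hρ : 𝒰.abd2 F ρ = 0) :
    𝒰'.abd2 F (refineC2 r F ρ) = 0 := by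
  funext i₀ i₁ i₂ i₃ j₂₃ j₁₃ j₁₂ j₀₃ j₀₂ j₀₁
  have h := congrArg (fun c => F.res (Refinement.inter₆_le r j₂₃ j₁₃ j₁₂ j₀₃ j₀₂ j₀₁)
    (c (r.idx i₀) (r.idx i₁) (r.idx i₂) (r.idx i₃) (Refinement.idxJ r j₂₃) (Refinement.idxJ r j₁₃)
      (Refinement.idxJ r j₁₂) (Refinement.idxJ r j₀₃) (Refinement.idxJ r j₀₂)
      (Refinement.idxJ r j₀₁))) hρ
  simpa only [abd2_apply, refineC2_apply, map_sub, map_add, AbSheaf.res_res, Pi.zero_apply,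
    map_zero] using h

theorem refineC1_mapC1 (f : F ⟶ G) (σ : 𝒰.AbC1 F) :
    refineC1 r G (𝒰.mapC1 f σ) = 𝒰'.mapC1 f (refineC1 r F σ) := by
  funext i₀ i₁ j
  simp only [refineC1_apply, mapC1_apply, app_res]

theorem refineC2_mapC2 (f : F ⟶ G) (ρ : 𝒰.AbC2 F) :
    refineC2 r G (𝒰.mapC2 f ρ) = 𝒰'.mapC2 f (refineC2 r F ρ) := by
  funext i₀ i₁ i₂ j₁₂ j₀₂ j₀₁
  simp only [refineC2_apply, mapC2_apply, app_res]

end Refine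

/-! ### Exactness for sheaves of discontinuous sections -/

section Pi

variable (D : X → AddCommGrpCat.{u})

/-- Contraction at each point: fix `c x` with `x ∈ U (c x)` and, for each `i` with `x ∈ U i`, a
second-layer set for `(c x, i)` that contains `x`. Insert `c x` as the first index. The choices may
vary arbitrarily with `x` because sections of `pi D` satisfy no continuity condition. -/
theorem exists_abd0_eq_of_pi (σ : 𝒰.AbC1 (AbSheaf.pi D)) (hσ : 𝒰.abd1 _ σ = 0) :
    ∃ τ, 𝒰.abd0 _ τ = σ := by
  choose c hc using 𝒰.exists_mem_U
  choose k hk using fun (x : X) (i : 𝒰.I) (hi : x ∈ 𝒰.U i) => 𝒰.exists_mem_V (hc x) hi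
  refine ⟨fun i (x : 𝒰.U i) =>
    (σ (c x) i (k x i x.2) : ∀ y : 𝒰.V _ _, D y) ⟨x.1, hk x i x.2⟩, ?_⟩
  funext i₀ i₁ j
  refine funext fun (x : 𝒰.V _ j) => ?_
  have h₀ := 𝒰.V_le_left j x.2
  have h₁ := 𝒰.V_le_right j x.2
  -- The cocycle condition for `(c x, i₀, i₁)`, evaluated at `x`.
  have h := congrFun (congrFun (congrFun (congrFun (congrFun (congrFun (congrFun hσ
    (c x)) i₀) i₁) j) (k x i₁ h₁)) (k x i₀ h₀))
    (⟨x.1, ⟨x.2, hk x i₁ h₁⟩, hk x i₀ h₀⟩ : 𝒰.inter₃ j (k x i₁ h₁) (k x i₀ h₀))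
  change (σ i₀ i₁ j : ∀ y : 𝒰.V _ _, D y) x - _ + _ = 0 at h
  rw [sub_add, sub_eq_zero] at h
  exact h.symm

/-- The same contraction one degree higher. The set `k x i` depends only on `x` and `i`, so the
three values of the primitive use matching choices. -/
theorem exists_abd1_eq_of_pi (ρ : 𝒰.AbC2 (AbSheaf.pi D)) (hρ : 𝒰.abd2 _ ρ = 0) :
    ∃ σ, 𝒰.abd1 _ σ = ρ := by
  choose c hc using 𝒰.exists_mem_U
  choose k hk using fun (x : X) (i : 𝒰.I) (hi : x ∈ 𝒰.U i) => 𝒰.exists_mem_V (hc x) hi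
  refine ⟨fun i₀ i₁ j (x : 𝒰.V _ j) =>
    (ρ (c x) i₀ i₁ j (k x i₁ (𝒰.V_le_right j x.2)) (k x i₀ (𝒰.V_le_left j x.2)) :
      ∀ y : 𝒰.inter₃ _ _ _, D y) ⟨x.1, ⟨x.2, hk x i₁ _⟩, hk x i₀ _⟩, ?_⟩
  funext i₀ i₁ i₂ j₁₂ j₀₂ j₀₁
  refine funext fun (x : 𝒰.inter₃ j₁₂ j₀₂ j₀₁) => ?_
  have h₀ := 𝒰.V_le_left j₀₁ x.2.2
  have h₁ := 𝒰.V_le_right j₀₁ x.2.2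
  have h₂ := 𝒰.V_le_right j₁₂ x.2.1.1
  have h := congrFun (congrFun (congrFun (congrFun (congrFun (congrFun (congrFun (congrFun (congrFun
    (congrFun (congrFun hρ (c x)) i₀) i₁) i₂) j₁₂) j₀₂) j₀₁)
    (k x i₂ h₂)) (k x i₁ h₁)) (k x i₀ h₀))
    (⟨x.1, x.2, ⟨hk x i₂ h₂, hk x i₁ h₁⟩, hk x i₀ h₀⟩ :
      𝒰.inter₆ j₁₂ j₀₂ j₀₁ (k x i₂ h₂) (k x i₁ h₁) (k x i₀ h₀))
  change (ρ i₀ i₁ i₂ j₁₂ j₀₂ j₀₁ : ∀ y : 𝒰.inter₃ _ _ _, D y) x - _ + _ - _ = 0 at h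
  rw [sub_add, sub_sub, sub_eq_zero] at h
  exact h.symm

end Pi

end LevelTwoCover

/-! ### Homomorphisms defined by additive relations -/

/-- A total additive relation `r` whose fibre over `0` is killed by `f` induces a homomorphism. -/
theorem AddMonoidHom.exists_of_relation {A B C : Type*} [AddCommGroup A] [AddCommGroup B]
    [AddCommGroup C] (r : A → B → Prop) (f : B →+ C) (total : ∀ a, ∃ b, r a b)
    (hsub : ∀ a a' b b', r a b → r a' b' → r (a - a') (b - b')) (hzero : ∀ b, r 0 b → f b = 0) :
    ∃ g : A →+ C, ∀ a b, r a b → g a = f b := by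
  choose b hb using total
  have key (a : A) (b' b'' : B) (h' : r a b') (h'' : r a b'') : f b' = f b'' := by
    have h := hzero _ (sub_self a ▸ hsub _ _ _ _ h' h'')
    rwa [map_sub, sub_eq_zero] at h
  refine ⟨AddMonoidHom.mk' (fun a => f (b a)) fun a a' => ?_, fun a b' h => key a _ _ (hb a) h⟩
  -- Closure under sums comes from closure under differences, as `a + a' = a - (0 - a')`.
  have h₀ : r 0 0 := by simpa using hsub _ _ _ _ (hb a) (hb a)
  have h : r (a + a') (b a + b a') := by simpa using hsub _ _ _ _ (hb a) (hsub _ _ _ _ h₀ (hb a'))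
  rw [← map_add]
  exact key _ _ _ (hb _) h

namespace LevelTwoCover

open AbSheaf

variable {X : TopCat.{u}} {𝒰 : LevelTwoCover X} {F G : AbSheaf X}

/-! ### The class of a `1`-cocycle -/

/-- The `1`-cocycle `σ` is the coboundary of a cochain with values in `hull F` whose image in
`hull F / F` is given by the global section `s`. -/
def Represents₁ (σ : (𝒰.abd1 F).ker) (s : F.cosyzygy.sec ⊤) : Prop :=
  ∃ τ : 𝒰.AbC0 F.hull, 𝒰.abd0 _ τ = 𝒰.mapC1 F.toHull σ.1 ∧
    ∀ i, app F.hullProj _ (τ i) = F.cosyzygy.res le_top s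

/-- The cocycle condition gives agreement only on the second-layer sets; since these cover `U i₀ ⊓ U
i₁`, separatedness gives agreement there and the sections glue. -/
theorem exists_section_of_abd0_eq_zero {τ : 𝒰.AbC0 F} (hτ : 𝒰.abd0 F τ = 0) :
    ∃ s : F.sec ⊤, ∀ i, F.res le_top s = τ i := by
  refine F.exists_glue 𝒰.U (fun _ => le_top) 𝒰.iSup_U.ge τ fun i₀ i₁ => ?_
  refine F.sec_ext (𝒰.V s(i₀, i₁)) 𝒰.V_le_inf (𝒰.iSup_V i₀ i₁).ge fun j => ?_
  have h := congrFun (congrFun (congrFun hτ i₀) i₁) j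
  rw [AbSheaf.res_res, AbSheaf.res_res]
  exact (sub_eq_zero.1 h).symm

theorem exists_represents₁ (σ : (𝒰.abd1 F).ker) : ∃ s, Represents₁ σ s := by
  obtain ⟨τ, hτ⟩ := exists_abd0_eq_of_pi _ (𝒰.mapC1 F.toHull σ.1) (by
    rw [abd1_mapC1, AddMonoidHom.mem_ker.1 σ.2, map_zero])
  obtain ⟨s, hs⟩ := exists_section_of_abd0_eq_zero (τ := 𝒰.mapC0 F.hullProj τ) (by
    rw [abd0_mapC0, hτ, mapC1_hullProj_toHull])
  exact ⟨s, τ, hτ, fun i => (hs i).symm⟩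

theorem Represents₁.sub {σ σ' : (𝒰.abd1 F).ker} {s s' : F.cosyzygy.sec ⊤} (h : Represents₁ σ s)
    (h' : Represents₁ σ' s') : Represents₁ (σ - σ') (s - s') := by
  obtain ⟨τ, hτ, hs⟩ := h
  obtain ⟨τ', hτ', hs'⟩ := h'
  refine ⟨τ - τ', ?_, fun i => ?_⟩
  · rw [map_sub, hτ, hτ', AddSubgroup.coe_sub, map_sub]
  · rw [Pi.sub_apply, map_sub, hs, hs', map_sub]

/-- When the cocycle is zero, `τ` glues to a global section of `hull F` that lifts `s`, so `s` has
no obstruction. -/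
theorem Represents₁.connecting₀_eq_zero {s : F.cosyzygy.sec ⊤}
    (h : Represents₁ (0 : (𝒰.abd1 F).ker) s) :
    connecting₀ F.hullComplex_shortExact s = 0 := by
  obtain ⟨τ, hτ, hs⟩ := h
  obtain ⟨t, ht⟩ := exists_section_of_abd0_eq_zero (τ := τ) (hτ.trans (map_zero _))
  have h : app F.hullProj ⊤ t = s :=
    F.cosyzygy.sec_ext 𝒰.U (fun _ => le_top) 𝒰.iSup_U.ge fun i => by
      rw [← app_res, ht, hs]
  rw [← h]
  exact connecting₀_app F.hullComplex_shortExact t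

variable (𝒰 F) in
theorem exists_class₁ : ∃ g : (𝒰.abd1 F).ker →+ Sheaf.H F 1, ∀ σ s, Represents₁ σ s →
    g σ = connecting₀ F.hullComplex_shortExact s :=
  AddMonoidHom.exists_of_relation _ _ exists_represents₁ (fun _ _ _ _ => Represents₁.sub)
    fun _ => Represents₁.connecting₀_eq_zero

variable (𝒰 F) in
/-- The cohomology class of a `1`-cocycle. -/
noncomputable def class₁ : (𝒰.abd1 F).ker →+ Sheaf.H F 1 :=
  (𝒰.exists_class₁ F).choose

theorem Represents₁.class₁_eq {σ : (𝒰.abd1 F).ker} {s : F.cosyzygy.sec ⊤}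
    (h : Represents₁ σ s) : 𝒰.class₁ F σ = connecting₀ F.hullComplex_shortExact s :=
  (𝒰.exists_class₁ F).choose_spec σ s h

/-- The image of a `1`-cocycle under a morphism of sheaves. -/
noncomputable def mapZ1 (f : F ⟶ G) (σ : (𝒰.abd1 F).ker) : (𝒰.abd1 G).ker :=
  ⟨𝒰.mapC1 f σ.1, AddMonoidHom.mem_ker.2 (by
    rw [abd1_mapC1, AddMonoidHom.mem_ker.1 σ.2, map_zero])⟩

/-- The restriction of a `1`-cocycle to a refinement. -/
noncomputable def refineZ1 {𝒰' : LevelTwoCover X} (r : 𝒰' ⟶ 𝒰) (σ : (𝒰.abd1 F).ker) :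
    (𝒰'.abd1 F).ker :=
  ⟨refineC1 r F σ.1, AddMonoidHom.mem_ker.2 (by
    rw [abd1_refineC1, AddMonoidHom.mem_ker.1 σ.2, map_zero])⟩

theorem class₁_mapZ1 (f : F ⟶ G) (σ : (𝒰.abd1 F).ker) :
    𝒰.class₁ G (mapZ1 f σ) = Sheaf.H.map f 1 (𝒰.class₁ F σ) := by
  obtain ⟨φ, rfl⟩ := exists_hullComplex_map f
  obtain ⟨s, h⟩ := exists_represents₁ σ
  have h' : Represents₁ (mapZ1 φ.τ₁ σ) (app φ.τ₃ ⊤ s) := by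
    obtain ⟨τ, hτ, hs⟩ := h
    refine ⟨𝒰.mapC0 φ.τ₂ τ, ?_, fun i => ?_⟩
    · rw [abd0_mapC0, hτ, mapZ1, ← mapC1_comp]
      exact congrArg (fun g => 𝒰.mapC1 g σ.1) φ.comm₁₂.symm
    · refine (congrArg (fun g => app g _ (τ i)) φ.comm₂₃).trans ?_
      exact (congrArg (app φ.τ₃ _) (hs i)).trans (app_res φ.τ₃ _ s)
  rw [h.class₁_eq, h'.class₁_eq]
  exact (map_connecting₀ _ _ φ s).symm

theorem class₁_refineZ1 {𝒰' : LevelTwoCover X} (r : 𝒰' ⟶ 𝒰) (σ : (𝒰.abd1 F).ker) :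
    𝒰'.class₁ F (refineZ1 r σ) = 𝒰.class₁ F σ := by
  obtain ⟨s, h⟩ := exists_represents₁ σ
  have h' : Represents₁ (refineZ1 r σ) s := by
    obtain ⟨τ, hτ, hs⟩ := h
    refine ⟨refineC0 r _ τ, ?_, fun i => ?_⟩
    · rw [abd0_refineC0, hτ, refineZ1, refineC1_mapC1]
    · rw [refineC0_apply, app_res, hs, AbSheaf.res_res]
  rw [h.class₁_eq, h'.class₁_eq]

/-- In degree 1 no refinement is needed: the representing section lifts to a global section `t` of
`hull F`. Subtracting `t` from `τ` leaves its coboundary unchanged and moves its values into `F`. -/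
theorem exists_abd0_eq_of_class₁_eq_zero {σ : (𝒰.abd1 F).ker} (hσ : 𝒰.class₁ F σ = 0) :
    ∃ φ, 𝒰.abd0 F φ = σ.1 := by
  obtain ⟨s, h⟩ := exists_represents₁ σ
  obtain ⟨t, rfl⟩ := exists_of_connecting₀_eq_zero F.hullComplex_shortExact
    (h.class₁_eq.symm.trans hσ)
  obtain ⟨τ, hτ, hs⟩ := h
  obtain ⟨φ, hφ⟩ := exists_mapC0_toHull_eq (F := F)
    (τ := τ - fun i => F.hull.res (le_top : 𝒰.U i ≤ ⊤) t) (by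
      funext i
      rw [mapC0_apply, Pi.sub_apply, map_sub, hs, app_res]
      exact sub_self _)
  refine ⟨φ, mapC1_injective F.toHull ?_⟩
  rw [← abd0_mapC0, hφ, map_sub, hτ, sub_eq_self]
  funext i₀ i₁ j
  rw [abd0_apply, AbSheaf.res_res, AbSheaf.res_res]
  exact sub_self _

/-! ### The class of a `2`-cocycle -/

/-- The `2`-cocycle `ρ` is the coboundary of a cochain with values in `hull F` whose image in
`hull F / F` is the cocycle `σ`. -/
def Represents₂ (ρ : (𝒰.abd2 F).ker) (σ : (𝒰.abd1 F.cosyzygy).ker) : Prop :=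
  ∃ τ : 𝒰.AbC1 F.hull, 𝒰.abd1 _ τ = 𝒰.mapC2 F.toHull ρ.1 ∧ 𝒰.mapC1 F.hullProj τ = σ.1

theorem exists_represents₂ (ρ : (𝒰.abd2 F).ker) : ∃ σ, Represents₂ ρ σ := by
  obtain ⟨τ, hτ⟩ := exists_abd1_eq_of_pi _ (𝒰.mapC2 F.toHull ρ.1) (abd2_mapC2 _ ρ.2)
  refine ⟨⟨𝒰.mapC1 F.hullProj τ, AddMonoidHom.mem_ker.2 ?_⟩, τ, hτ, rfl⟩
  rw [abd1_mapC1, hτ, mapC2_hullProj_toHull]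

theorem Represents₂.sub {ρ ρ' : (𝒰.abd2 F).ker} {σ σ' : (𝒰.abd1 F.cosyzygy).ker}
    (h : Represents₂ ρ σ) (h' : Represents₂ ρ' σ') : Represents₂ (ρ - ρ') (σ - σ') := by
  obtain ⟨τ, hτ, hs⟩ := h
  obtain ⟨τ', hτ', hs'⟩ := h'
  refine ⟨τ - τ', ?_, ?_⟩
  · rw [map_sub, hτ, hτ', AddSubgroup.coe_sub, map_sub]
  · rw [map_sub, hs, hs', AddSubgroup.coe_sub]

/-- For a zero 2-cocycle, `τ` is itself a 1-cocycle of `hull F`, so the class of `σ` comes from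
`H¹(X, hull F) = 0`. -/
theorem Represents₂.class₁_eq_zero {σ : (𝒰.abd1 F.cosyzygy).ker}
    (h : Represents₂ (0 : (𝒰.abd2 F).ker) σ) : 𝒰.class₁ _ σ = 0 := by
  obtain ⟨τ, hτ, hσ⟩ := h
  have e : σ = mapZ1 F.hullProj ⟨τ, AddMonoidHom.mem_ker.2 (hτ.trans (map_zero _))⟩ :=
    Subtype.ext hσ.symm
  have : Subsingleton (Sheaf.H F.hull 1) := inferInstanceAs (Subsingleton (Sheaf.H F.hull (0 + 1)))
  rw [e, class₁_mapZ1, Subsingleton.elim (class₁ _ _ _) 0, map_zero]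

variable (𝒰 F) in
theorem exists_class₂ : ∃ g : (𝒰.abd2 F).ker →+ Sheaf.H F 2, ∀ ρ σ, Represents₂ ρ σ →
    g ρ = connecting₁ F.hullComplex_shortExact (𝒰.class₁ F.cosyzygy σ) :=
  AddMonoidHom.exists_of_relation Represents₂
    ((connecting₁ F.hullComplex_shortExact).comp (𝒰.class₁ F.cosyzygy)) exists_represents₂
    (fun _ _ _ _ => Represents₂.sub) fun _ h =>
      (congrArg (connecting₁ F.hullComplex_shortExact) h.class₁_eq_zero).trans (map_zero _)

variable (𝒰 F) in
/-- The cohomology class of a `2`-cocycle. -/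
noncomputable def class₂ : (𝒰.abd2 F).ker →+ Sheaf.H F 2 :=
  (𝒰.exists_class₂ F).choose

theorem Represents₂.class₂_eq {ρ : (𝒰.abd2 F).ker} {σ : (𝒰.abd1 F.cosyzygy).ker}
    (h : Represents₂ ρ σ) :
    𝒰.class₂ F ρ = connecting₁ F.hullComplex_shortExact (𝒰.class₁ F.cosyzygy σ) :=
  (𝒰.exists_class₂ F).choose_spec ρ σ h

/-- The image of a `2`-cocycle under a morphism of sheaves. -/
noncomputable def mapZ2 (f : F ⟶ G) (ρ : (𝒰.abd2 F).ker) : (𝒰.abd2 G).ker :=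
  ⟨𝒰.mapC2 f ρ.1, AddMonoidHom.mem_ker.2 (abd2_mapC2 f ρ.2)⟩

/-- The restriction of a `2`-cocycle to a refinement. -/
noncomputable def refineZ2 {𝒰' : LevelTwoCover X} (r : 𝒰' ⟶ 𝒰) (ρ : (𝒰.abd2 F).ker) :
    (𝒰'.abd2 F).ker :=
  ⟨refineC2 r F ρ.1, AddMonoidHom.mem_ker.2 (abd2_refineC2 r ρ.2)⟩

theorem class₂_mapZ2 (f : F ⟶ G) (ρ : (𝒰.abd2 F).ker) :
    𝒰.class₂ G (mapZ2 f ρ) = Sheaf.H.map f 2 (𝒰.class₂ F ρ) := by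
  obtain ⟨φ, rfl⟩ := exists_hullComplex_map f
  obtain ⟨σ, h⟩ := exists_represents₂ ρ
  have h' : Represents₂ (mapZ2 φ.τ₁ ρ) (mapZ1 (F := F.cosyzygy) (G := G.cosyzygy) φ.τ₃ σ) := by
    obtain ⟨τ, hτ, hσ⟩ := h
    refine ⟨𝒰.mapC1 φ.τ₂ τ, ?_, ?_⟩
    · rw [abd1_mapC1, hτ, mapZ2, ← mapC2_comp]
      exact congrArg (fun g => 𝒰.mapC2 g ρ.1) φ.comm₁₂.symm
    · refine (congrArg (fun g => 𝒰.mapC1 g τ) φ.comm₂₃).trans ?_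
      exact congrArg (𝒰.mapC1 φ.τ₃) hσ
  rw [h.class₂_eq, h'.class₂_eq, class₁_mapZ1]
  exact (map_connecting₁ _ _ φ _).symm

theorem class₂_refineZ2 {𝒰' : LevelTwoCover X} (r : 𝒰' ⟶ 𝒰) (ρ : (𝒰.abd2 F).ker) :
    𝒰'.class₂ F (refineZ2 r ρ) = 𝒰.class₂ F ρ := by
  obtain ⟨σ, h⟩ := exists_represents₂ ρ
  have h' : Represents₂ (refineZ2 r ρ) (refineZ1 r σ) := by
    obtain ⟨τ, hτ, hσ⟩ := h
    refine ⟨refineC1 r _ τ, ?_, ?_⟩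
    · rw [abd1_refineC1, hτ, refineZ2, refineC2_mapC2]
    · rw [← refineC1_mapC1, hσ, refineZ1]
  rw [h.class₂_eq, h'.class₂_eq, class₁_refineZ1]

theorem class₂_abd1 (φ : 𝒰.AbC1 F) {ρ : (𝒰.abd2 F).ker} (hρ : 𝒰.abd1 F φ = ρ.1) :
    𝒰.class₂ F ρ = 0 := by
  have h : Represents₂ ρ 0 :=
    ⟨𝒰.mapC1 F.toHull φ, by rw [abd1_mapC1, hρ], mapC1_hullProj_toHull φ⟩
  rw [h.class₂_eq, map_zero, map_zero]

/-! ### Refining the first layer of a cover -/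

/-- The intersection of the two sets of a family indexed by an unordered pair. -/
def symInf {I : Type*} (U : I → Opens X) : Sym2 I → Opens X :=
  Sym2.lift ⟨fun i₀ i₁ => U i₀ ⊓ U i₁, fun _ _ => inf_comm _ _⟩

/-- The cover of level `2` obtained by pulling back `𝒰` to a refinement `(U' i')` of its first
layer. -/
def pullback (𝒰 : LevelTwoCover X) {I' : Type u} (π : I' → 𝒰.I) (U' : I' → Opens X)
    (hU' : ∀ i, U' i ≤ 𝒰.U (π i)) (hX : ⨆ i, U' i = ⊤) : LevelTwoCover X where
  I := I'
  U := U'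
  iSup_U := hX
  J s := 𝒰.J (s.map π)
  V s j := 𝒰.V (s.map π) j ⊓ symInf U' s
  unique_diag i := 𝒰.unique_diag (π i)
  iSup_V i₀ i₁ := by
    change ⨆ j : 𝒰.J s(π i₀, π i₁), 𝒰.V s(π i₀, π i₁) j ⊓ (U' i₀ ⊓ U' i₁) = U' i₀ ⊓ U' i₁
    rw [← iSup_inf_eq, 𝒰.iSup_V]
    exact inf_eq_right.2 (inf_le_inf (hU' i₀) (hU' i₁))

/-- The projection from a pulled back cover. -/
def pullbackHom (𝒰 : LevelTwoCover X) {I' : Type u} (π : I' → 𝒰.I) (U' : I' → Opens X)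
    (hU' : ∀ i, U' i ≤ 𝒰.U (π i)) (hX : ⨆ i, U' i = ⊤) : 𝒰.pullback π U' hU' hX ⟶ 𝒰 where
  idx := π
  idx₂ _ j := j
  U_le := hU'
  V_le _ _ := inf_le_left

/-- The primitive `ψ` of `ρ` in `hull F` fails to lie in `F` by a 1-cocycle `σ` of the quotient.
Vanishing of the class makes `σ` a coboundary of `τ`; after `τ` is lifted locally to `t`, the
cochain `ψ - dt` lies in `F` and has the same coboundary as `ψ`. -/
theorem exists_refine_eq_abd1_of_class₂_eq_zero {ρ : (𝒰.abd2 F).ker} (hρ : 𝒰.class₂ F ρ = 0) :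
    ∃ (𝒰' : LevelTwoCover X) (r : 𝒰' ⟶ 𝒰) (φ : 𝒰'.AbC1 F),
      𝒰'.abd1 F φ = refineC2 r F ρ.1 := by
  obtain ⟨σ, h⟩ := exists_represents₂ ρ
  obtain ⟨τ, hτ⟩ := exists_abd0_eq_of_class₁_eq_zero
    ((injective_iff_map_eq_zero _).1 (connecting₁_injective F.hullComplex_shortExact) _
      (h.class₂_eq.symm.trans hρ))
  obtain ⟨ψ, hψ, hσ⟩ := h
  -- All open subsets of `U i` over which `τ i` lifts to `hull F`. Only the first layer is refined;
  -- the second is pulled back.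
  let I' : Type u := Σ i : 𝒰.I, { W : Opens X // ∃ h : W ≤ 𝒰.U i,
    ∃ t, app F.hullProj W t = F.cosyzygy.res h (τ i) }
  let 𝒰' := 𝒰.pullback (I' := I') Sigma.fst (fun i => i.2.1) (fun i => i.2.2.1) <| by
    refine eq_top_iff.2 fun x _ => ?_
    obtain ⟨i, hi⟩ := 𝒰.exists_mem_U x
    obtain ⟨W, hW, hx, t, ht⟩ := exists_local_lift F.hullProj (τ i) hi
    exact Opens.mem_iSup.2 ⟨⟨i, W, hW, t, ht⟩, hx⟩
  let r : 𝒰' ⟶ 𝒰 := 𝒰.pullbackHom _ _ _ _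
  choose t ht using fun i : I' => i.2.2.2
  let t' : 𝒰'.AbC0 F.hull := t
  have ht' : 𝒰'.mapC0 F.hullProj t' = refineC0 r _ τ := funext ht
  obtain ⟨φ, hφ⟩ := exists_mapC1_toHull_eq (σ := refineC1 r _ ψ - 𝒰'.abd0 _ t') (by
    rw [map_sub, ← refineC1_mapC1, hσ, ← hτ, ← abd0_mapC0, ht', abd0_refineC0, sub_self])
  refine ⟨𝒰', r, φ, mapC2_injective F.toHull ?_⟩
  rw [← abd1_mapC1, hφ, map_sub, abd1_abd0, sub_zero, abd1_refineC1, hψ, refineC2_mapC2]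

/-! ### Every class comes from a cover -/

/-- The cover of level `2` given by an open cover `(U i)` and, for each unordered pair `s`, the
collection of all open sets that satisfy `P s`. -/
def ofPredicate {I : Type u} (U : I → Opens X) (hU : ⨆ i, U i = ⊤) (P : Sym2 I → Opens X → Prop)
    (hle : ∀ i₀ i₁ W, P s(i₀, i₁) W → W ≤ U i₀ ⊓ U i₁)
    (hdiag : ∀ i, P s(i, i) (U i))
    (hP : ∀ i₀ i₁, ∀ x ∈ U i₀ ⊓ U i₁, ∃ W, P s(i₀, i₁) W ∧ x ∈ W) : LevelTwoCover X where
  I := I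
  U := U
  iSup_U := hU
  -- The second condition is vacuous off the diagonal and leaves only `U i` on it.
  J s := { W : Opens X // P s W ∧ ∀ i, s = s(i, i) → W = U i }
  V _ W := W.1
  unique_diag i := ⟨⟨⟨U i, hdiag i, fun i' h => by
      rw [Sym2.eq_iff] at h
      obtain ⟨rfl, -⟩ | ⟨rfl, -⟩ := h <;> rfl⟩⟩, fun W => Subtype.ext (W.2.2 i rfl)⟩
  iSup_V i₀ i₁ := by
    refine le_antisymm (iSup_le fun W => hle _ _ _ W.2.1) fun x hx => Opens.mem_iSup.2 ?_
    obtain rfl | hne := eq_or_ne i₀ i₁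
    · exact ⟨⟨U i₀, hdiag i₀, fun i' h => by
        rw [Sym2.eq_iff] at h
        obtain ⟨rfl, -⟩ | ⟨rfl, -⟩ := h <;> rfl⟩, hx.1⟩
    · obtain ⟨W, hW, hxW⟩ := hP i₀ i₁ x hx
      refine ⟨⟨W, hW, fun i h => ?_⟩, hxW⟩
      rw [Sym2.eq_iff] at h
      obtain ⟨rfl, rfl⟩ | ⟨rfl, rfl⟩ := h <;> exact absurd rfl hne

/-- The first layer consists of the open sets over which `s` lifts; the second consists of open sets
over which the differences of these lifts, as sections of `cosyzygy F`, lift further to `hull F`. -/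
theorem exists_cover_of_section (s : F.cosyzygy.cosyzygy.sec ⊤) :
    ∃ (𝒰 : LevelTwoCover X) (τ : 𝒰.AbC0 F.cosyzygy.hull) (σ : 𝒰.AbC1 F.cosyzygy)
      (ψ : 𝒰.AbC1 F.hull),
      (∀ i, app F.cosyzygy.hullProj _ (τ i) = F.cosyzygy.cosyzygy.res le_top s) ∧
        𝒰.abd0 _ τ = 𝒰.mapC1 F.cosyzygy.toHull σ ∧ 𝒰.mapC1 F.hullProj ψ = σ := by
  let I : Type u :=
    { W : Opens X // ∃ t, app F.cosyzygy.hullProj W t = F.cosyzygy.cosyzygy.res le_top s }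
  let U : I → Opens X := Subtype.val
  have hU : ⨆ i, U i = ⊤ := by
    refine eq_top_iff.2 fun x hx => ?_
    obtain ⟨W, hW, hxW, t, ht⟩ := exists_local_lift F.cosyzygy.hullProj s hx
    exact Opens.mem_iSup.2 ⟨⟨W, t, ht⟩, hxW⟩
  choose τ hτ using fun i : I => i.2
  have (i₀ i₁ : I) : ∃ t : F.cosyzygy.sec (U i₀ ⊓ U i₁), app F.cosyzygy.toHull _ t =
      F.cosyzygy.hull.res inf_le_right (τ i₁) - F.cosyzygy.hull.res inf_le_left (τ i₀) := by
    refine exists_toHull_eq _ ?_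
    rw [map_sub, app_res, app_res, hτ, hτ, AbSheaf.res_res, AbSheaf.res_res]
    exact sub_self _
  choose σ hσ using this
  -- The second layer is indexed by unordered pairs, so one set `W` must serve both `σ i₀ i₁` and `σ
  -- i₁ i₀`; local lifts of the two are later restricted to a common neighbourhood.
  let P : Sym2 I → Opens X → Prop := fun s W => ∀ i₀ i₁, s = s(i₀, i₁) →
    ∃ h : W ≤ U i₀ ⊓ U i₁, ∃ t, app F.hullProj W t = F.cosyzygy.res h (σ i₀ i₁)
  have hdiag (i : I) : P s(i, i) (U i) := fun i₀ i₁ h => by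
    obtain ⟨rfl, rfl⟩ : i = i₀ ∧ i = i₁ := by
      rw [Sym2.eq_iff] at h
      tauto
    -- On the diagonal the difference of lifts vanishes, so it lifts over all of `U i`, as the
    -- one-set cover there demands.
    have h0 : σ i i = 0 := by
      refine app_injective F.cosyzygy.toHull _ ?_
      rw [hσ, map_zero]
      exact sub_self _
    exact ⟨le_inf le_rfl le_rfl, 0, by rw [h0, map_zero, map_zero]⟩
  have hP (i₀ i₁ : I) (x : X) (hx : x ∈ U i₀ ⊓ U i₁) : ∃ W, P s(i₀, i₁) W ∧ x ∈ W := by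
    obtain ⟨W, hW, hxW, t, ht⟩ := exists_local_lift F.hullProj (σ i₀ i₁) hx
    obtain ⟨W', hW', hxW', t', ht'⟩ := exists_local_lift F.hullProj (σ i₁ i₀) hx.symm
    refine ⟨W ⊓ W', fun k₀ k₁ h => ?_, hxW, hxW'⟩
    rw [Sym2.eq_iff] at h
    obtain ⟨rfl, rfl⟩ | ⟨rfl, rfl⟩ := h
    · exact ⟨inf_le_left.trans hW, F.hull.res inf_le_left t, by
        rw [app_res, ht, AbSheaf.res_res]⟩
    · exact ⟨inf_le_right.trans hW', F.hull.res inf_le_right t', by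
        rw [app_res, ht', AbSheaf.res_res]⟩
  have hτσ (i₀ i₁ : I) (W : Opens X) (h : W ≤ U i₀ ⊓ U i₁) :
      F.cosyzygy.hull.res (h.trans inf_le_right) (τ i₁) -
        F.cosyzygy.hull.res (h.trans inf_le_left) (τ i₀) =
      app F.cosyzygy.toHull W (F.cosyzygy.res h (σ i₀ i₁)) := by
    rw [app_res, hσ, map_sub, AbSheaf.res_res, AbSheaf.res_res]
  let 𝒰 : LevelTwoCover X := ofPredicate U hU P (fun i₀ i₁ W h => (h i₀ i₁ rfl).1) hdiag hP
  choose ψ hψ using fun (i₀ i₁ : I) (j : 𝒰.J s(i₀, i₁)) => (j.2.1 i₀ i₁ rfl).2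
  exact ⟨𝒰, τ, fun i₀ i₁ j => F.cosyzygy.res (𝒰.V_le_inf j) (σ i₀ i₁), ψ, hτ,
    funext fun i₀ => funext fun i₁ => funext fun j => hτσ i₀ i₁ _ (𝒰.V_le_inf j),
    funext fun i₀ => funext fun i₁ => funext fun j => hψ i₀ i₁ j⟩

/-- Run the construction of the class backwards: the section gives `σ`, a lift `ψ` of `σ` to `hull
F` has a coboundary that dies in the quotient, and this coboundary is the required cocycle of `F`.
-/
theorem exists_class₂_eq (y : Sheaf.H F 2) :
    ∃ (𝒰 : LevelTwoCover X) (ρ : (𝒰.abd2 F).ker), 𝒰.class₂ F ρ = y := by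
  obtain ⟨z, rfl⟩ := connecting₁_surjective F.hullComplex_shortExact y
  obtain ⟨s, rfl⟩ := connecting₀_surjective F.cosyzygy.hullComplex_shortExact z
  obtain ⟨𝒰, τ, σ, ψ, hτ, hτσ, hψ⟩ := exists_cover_of_section s
  have hσ : 𝒰.abd1 _ σ = 0 := by
    refine mapC2_injective F.cosyzygy.toHull ?_
    rw [← abd1_mapC1, ← hτσ, abd1_abd0, map_zero]
  have h₁ : Represents₁ ⟨σ, AddMonoidHom.mem_ker.2 hσ⟩ s := ⟨τ, hτσ, hτ⟩
  obtain ⟨ρ, hρ⟩ := exists_mapC2_toHull_eq (ρ := 𝒰.abd1 _ ψ) (by rw [← abd1_mapC1, hψ, hσ])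
  have hρ' : 𝒰.abd2 F ρ = 0 := abd2_eq_zero_of_mapC2 F.toHull (by rw [hρ, abd2_abd1])
  have h₂ : Represents₂ ⟨ρ, AddMonoidHom.mem_ker.2 hρ'⟩ ⟨σ, AddMonoidHom.mem_ker.2 hσ⟩ :=
    ⟨ψ, hρ.symm, hψ⟩
  exact ⟨𝒰, _, by rw [h₂.class₂_eq, h₁.class₁_eq]⟩

end LevelTwoCover

/-! ### Colimits of modules over codirected categories -/

/-- A cocone of modules over a codirected category is a colimit if its maps are jointly surjective
and each element that they kill dies at a later stage. -/
theorem ModuleCat.nonempty_isColimit_of_codirected {R : Type u} [Ring R] {C : Type*} [Category C]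
    {D : Cᵒᵖ ⥤ ModuleCat.{u} R} (c : Limits.Cocone D)
    (hC : ∀ A B : C, ∃ Z : C, Nonempty (Z ⟶ A) ∧ Nonempty (Z ⟶ B))
    (surj : ∀ y : c.pt, ∃ (A : C) (x : D.obj (op A)), c.ι.app (op A) x = y)
    (inj : ∀ (A : C) (x : D.obj (op A)), c.ι.app (op A) x = 0 →
      ∃ (B : C) (f : B ⟶ A), D.map f.op x = 0) : Nonempty (Limits.IsColimit c) := by
  choose A x hx using surj
  have w (s : Limits.Cocone D) {B B' : C} (f : B' ⟶ B) (y : D.obj (op B)) :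
      s.ι.app (op B') (D.map f.op y) = s.ι.app (op B) y :=
    ConcreteCategory.congr_hom (s.w f.op) y
  -- Elements with equal image in `c` have equal image in every cocone: on a common `Z` their
  -- difference is killed by `c`, hence dies further on. Parallel arrows therefore need not be
  -- equalized in `C`.
  have key (s : Limits.Cocone D) {B B' : C} (y : D.obj (op B)) (y' : D.obj (op B'))
      (h : c.ι.app (op B) y = c.ι.app (op B') y') : s.ι.app (op B) y = s.ι.app (op B') y' := by
    obtain ⟨Z, ⟨f⟩, ⟨f'⟩⟩ := hC B B'
    obtain ⟨Z', g, hg⟩ := inj Z (D.map f.op y - D.map f'.op y') (by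
      rw [map_sub, w, w, h, sub_self])
    have h' := w s g (D.map f.op y - D.map f'.op y')
    rw [hg, map_zero, map_sub, w, w] at h'
    exact sub_eq_zero.1 h'.symm
  let d (s : Limits.Cocone D) : c.pt →ₗ[R] s.pt :=
    { toFun := fun y => s.ι.app (op (A y)) (x y)
      map_add' := fun y z => by
        obtain ⟨Z, ⟨f⟩, ⟨f'⟩⟩ := hC (A y) (A z)
        rw [← w s f, ← w s f', ← map_add]
        exact key s _ _ (by rw [map_add, w, w, hx, hx, hx])
      map_smul' := fun a y => by
        rw [RingHom.id_apply, ← map_smul]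
        exact key s _ _ (by rw [map_smul, hx, hx]) }
  refine ⟨{ desc := fun s => ModuleCat.ofHom (d s), fac := fun s B => ?_, uniq := fun s m hm => ?_ }⟩
  · refine ModuleCat.hom_ext (LinearMap.ext fun y => ?_)
    exact key s (B' := B.unop) _ y (hx _)
  · refine ModuleCat.hom_ext (LinearMap.ext fun y => ?_)
    have h := ConcreteCategory.congr_hom (hm (op (A y))) (x y)
    rw [ConcreteCategory.comp_apply, hx] at h
    exact h

/-! ### Common refinements and orders -/

namespace LevelTwoCover

variable {X : TopCat.{u}}

/-- A common refinement of two covers of level `2`. -/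
def prod (𝒰 𝒰' : LevelTwoCover X) : LevelTwoCover X where
  I := 𝒰.I × 𝒰'.I
  U i := 𝒰.U i.1 ⊓ 𝒰'.U i.2
  iSup_U := eq_top_iff.2 fun x _ => by
    obtain ⟨i, hi⟩ := 𝒰.exists_mem_U x
    obtain ⟨i', hi'⟩ := 𝒰'.exists_mem_U x
    exact Opens.mem_iSup.2 ⟨(i, i'), hi, hi'⟩
  J s := 𝒰.J (s.map Prod.fst) × 𝒰'.J (s.map Prod.snd)
  V s j := 𝒰.V _ j.1 ⊓ 𝒰'.V _ j.2
  unique_diag i := by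
    obtain ⟨u⟩ := 𝒰.unique_diag i.1
    obtain ⟨u'⟩ := 𝒰'.unique_diag i.2
    exact ⟨{ default := (u.default, u'.default), uniq := fun j => Prod.ext (u.uniq _) (u'.uniq _) }⟩
  iSup_V i₀ i₁ := by
    change ⨆ j : 𝒰.J s(i₀.1, i₁.1) × 𝒰'.J s(i₀.2, i₁.2),
      𝒰.V s(i₀.1, i₁.1) j.1 ⊓ 𝒰'.V s(i₀.2, i₁.2) j.2 = _
    rw [← iSup_inf_iSup, 𝒰.iSup_V, 𝒰'.iSup_V, inf_inf_inf_comm]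

/-- The first projection from a common refinement. -/
def prodFst (𝒰 𝒰' : LevelTwoCover X) : 𝒰.prod 𝒰' ⟶ 𝒰 where
  idx := Prod.fst
  idx₂ _ j := j.1
  U_le _ := inf_le_left
  V_le _ _ := inf_le_left

/-- The second projection from a common refinement. -/
def prodSnd (𝒰 𝒰' : LevelTwoCover X) : 𝒰.prod 𝒰' ⟶ 𝒰' where
  idx := Prod.snd
  idx₂ _ j := j.2
  U_le _ := inf_le_right
  V_le _ _ := inf_le_right

theorem sym2_map_map {I I' I'' : Type*} {π : I' → I''} {a : I → I'} {b : I → I''}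
    (h : ∀ i, π (a i) = b i) (s : Sym2 I) : s.map b = (s.map a).map π :=
  ((Sym2.map_map s).trans (congrArg (Sym2.map · s) (funext h))).symm

/-- A refinement of `𝒰` factors through the pullback of `𝒰` to any larger refinement of the first
layer. -/
def pullbackLift {𝒰 𝒰' : LevelTwoCover X} (r : 𝒰' ⟶ 𝒰) {I' : Type u} (π : I' → 𝒰.I)
    (U' : I' → Opens X) (hU' : ∀ i, U' i ≤ 𝒰.U (π i)) (hX : ⨆ i, U' i = ⊤) (a : 𝒰'.I → I')
    (ha : ∀ i, π (a i) = r.idx i) (hle : ∀ i, 𝒰'.U i ≤ U' (a i)) :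
    𝒰' ⟶ 𝒰.pullback π U' hU' hX where
  idx := a
  idx₂ s j := cast (congrArg 𝒰.J (sym2_map_map ha s)) (r.idx₂ s j)
  U_le := hle
  V_le s j := by
    change _ ≤ 𝒰.V ((s.map a).map π) (cast _ (r.idx₂ s j)) ⊓ symInf U' (s.map a)
    refine le_inf ((r.V_le s j).trans (𝒰.V_cast (sym2_map_map ha s) _).ge) ?_
    induction s using Sym2.ind with
    | _ i₀ i₁ => exact (𝒰'.V_le_inf j).trans (inf_le_inf (hle i₀) (hle i₁))

theorem pullbackLift_comp {𝒰 𝒰' : LevelTwoCover X} (r : 𝒰' ⟶ 𝒰) {I' : Type u} (π : I' → 𝒰.I)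
    (U' : I' → Opens X) (hU' : ∀ i, U' i ≤ 𝒰.U (π i)) (hX : ⨆ i, U' i = ⊤) (a : 𝒰'.I → I')
    (ha : π ∘ a = r.idx) (hle : ∀ i, 𝒰'.U i ≤ U' (a i)) :
    pullbackLift r π U' hU' hX a (congrFun ha) hle ≫ 𝒰.pullbackHom π U' hU' hX = r := by
  obtain ⟨idx, idx₂, _, _⟩ := r
  -- Substituting this equality makes the transport in `pullbackLift` trivial on each representative
  -- pair.
  have h : π ∘ a = idx := ha
  subst h
  refine Refinement.ext rfl (heq_of_eq ?_)
  funext s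
  induction s using Sym2.ind
  rfl

end LevelTwoCover

/-! ### Forgetting the orders on index sets -/

namespace OrderedLevelTwoCover

open LevelTwoCover

variable {X : TopCat.{u}}

/-- The linear order on a disjoint sum in which the first summand precedes the second. -/
@[reducible]
noncomputable def sumOrder {α β : Type u} (a : LinearOrder α) (b : LinearOrder β) :
    LinearOrder (α ⊕ β) :=
  inferInstanceAs (LinearOrder (α ⊕ₗ β))

theorem sumOrder_inl_le {α β : Type u} (a : LinearOrder α) (b : LinearOrder β) {x y : α}
    (h : x ≤ y) : (sumOrder a b).le (Sum.inl x) (Sum.inl y) :=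
  Sum.Lex.inl_le_inl_iff.2 h

theorem sumOrder_inr_le {α β : Type u} (a : LinearOrder α) (b : LinearOrder β) {x y : β}
    (h : x ≤ y) : (sumOrder a b).le (Sum.inr x) (Sum.inr y) :=
  Sum.Lex.inr_le_inr_iff.2 h

/-- Take the disjoint union of the two first layers and pull the second layer back from `𝒰`, which
supplies the data for mixed pairs. Placing one summand before the other makes both inclusions
order-preserving. -/
theorem exists_cocone {𝒰 : LevelTwoCover X} {𝒜 ℬ : OrderedLevelTwoCover X}
    (f : (forgetOrder X).obj 𝒜 ⟶ 𝒰) (g : (forgetOrder X).obj ℬ ⟶ 𝒰) :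
    ∃ (ℒ : OrderedLevelTwoCover X) (p : (forgetOrder X).obj ℒ ⟶ 𝒰) (a : 𝒜 ⟶ ℒ) (b : ℬ ⟶ ℒ),
      (forgetOrder X).map a ≫ p = f ∧ (forgetOrder X).map b ≫ p = g := by
  have hU : ∀ i, Sum.elim 𝒜.U ℬ.U i ≤ 𝒰.U (Sum.elim f.idx g.idx i) := by
    rintro (i | i)
    · exact f.U_le i
    · exact g.U_le i
  have hX : ⨆ i, Sum.elim 𝒜.U ℬ.U i = ⊤ := by
    rw [iSup_sum]
    exact (congrArg₂ _ 𝒜.iSup_U ℬ.iSup_U).trans (sup_idem _)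
  exact ⟨{ 𝒰.pullback _ _ hU hX with order := sumOrder 𝒜.order ℬ.order },
    𝒰.pullbackHom _ _ hU hX,
    ⟨pullbackLift f _ _ hU hX Sum.inl (fun _ => rfl) (fun _ => le_rfl),
      fun _ _ => sumOrder_inl_le 𝒜.order ℬ.order⟩,
    ⟨pullbackLift g _ _ hU hX Sum.inr (fun _ => rfl) (fun _ => le_rfl),
      fun _ _ => sumOrder_inr_le 𝒜.order ℬ.order⟩,
    pullbackLift_comp f _ _ hU hX _ rfl _, pullbackLift_comp g _ _ hU hX _ rfl _⟩

/-- Each comma category is nonempty because any index set can be well-ordered, and connected because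
any two objects map to a third by `exists_cocone`. -/
instance forgetOrder_initial : (forgetOrder X).Initial where
  out 𝒰 := by
    let 𝒱 : OrderedLevelTwoCover X := { 𝒰 with order := IsWellOrder.linearOrder WellOrderingRel }
    have : Nonempty (CostructuredArrow (forgetOrder X) 𝒰) :=
      ⟨CostructuredArrow.mk (S := forgetOrder X) (Y := 𝒱) (𝟙 𝒰)⟩
    refine zigzag_isConnected fun f g => ?_
    obtain ⟨ℒ, p, a, b, ha, hb⟩ := exists_cocone f.hom g.hom
    exact (Zigzag.of_hom (CostructuredArrow.homMk (f := f) (f' := CostructuredArrow.mk p) a ha)).trans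
      (Zigzag.of_inv (CostructuredArrow.homMk (f := g) (f' := CostructuredArrow.mk p) b hb))

end OrderedLevelTwoCover

/-! ### The comparison map for modules on a ringed space -/

namespace AlgebraicGeometry.RingedSpace

open LevelTwoCover

variable {X : RingedSpace.{u, u}}

/-- A `2`-cocycle of an `𝒪_X`-module, as a `2`-cocycle of the underlying abelian sheaf. -/
noncomputable def toAbZ2 (𝒰 : LevelTwoCover X.carrier) (F : X.Modules) :
    𝒰.Z2 (X.toPresheafModuleCat.obj F) →+ (𝒰.abd2 (toAbSheaf F)).ker :=
  AddMonoidHom.mk' (fun ρ => ⟨ρ.1, AddMonoidHom.mem_ker.2 ρ.2⟩) fun _ _ => rfl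

/-- The comparison map from cocycles to sheaf cohomology. -/
noncomputable def cocycleClass (𝒰 : LevelTwoCover X.carrier) (F : X.Modules) :
    𝒰.Z2 (X.toPresheafModuleCat.obj F) →ₗ[X.GlobalSections] H2 F where
  toFun ρ := 𝒰.class₂ _ (toAbZ2 𝒰 F ρ)
  map_add' ρ ρ' := (congrArg (𝒰.class₂ _) ((toAbZ2 𝒰 F).map_add ρ ρ')).trans
    ((𝒰.class₂ (toAbSheaf F)).map_add _ _)
  -- Scalars act on cohomology through sheaf endomorphisms, so linearity is an instance of
  -- naturality.
  map_smul' a ρ := class₂_mapZ2 (smulHom F a) (toAbZ2 𝒰 F ρ)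

/-- The comparison map from the cohomology of a cover of level `2` to sheaf cohomology. -/
noncomputable def comparison (𝒰 : LevelTwoCover X.carrier) (F : X.Modules) :
    coverH2 𝒰 F →ₗ[X.GlobalSections] H2 F :=
  Submodule.liftQ _ (cocycleClass 𝒰 F) <| by
    rintro _ ⟨φ, rfl⟩
    exact class₂_abd1 (F := toAbSheaf F) φ rfl

theorem comparison_map (𝒰 : LevelTwoCover X.carrier) {F G : X.Modules} (f : F ⟶ G)
    (x : coverH2 𝒰 F) : comparison 𝒰 G (coverH2map 𝒰 f x) = H2map f (comparison 𝒰 F x) := by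
  obtain ⟨ρ, rfl⟩ := Submodule.Quotient.mk_surjective _ x
  exact class₂_mapZ2 ((SheafOfModules.toSheaf X.ringSheaf).map f) (toAbZ2 𝒰 F ρ)

theorem comparison_refine (F : X.Modules) {𝒰' 𝒰 : LevelTwoCover X.carrier} (r : 𝒰' ⟶ 𝒰)
    (x : coverH2 𝒰 F) : comparison 𝒰' F (coverH2refine r F x) = comparison 𝒰 F x := by
  obtain ⟨ρ, rfl⟩ := Submodule.Quotient.mk_surjective _ x
  exact class₂_refineZ2 r (toAbZ2 𝒰 F ρ)

theorem exists_comparison_eq (F : X.Modules) (y : H2 F) :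
    ∃ (𝒰 : LevelTwoCover X.carrier) (x : coverH2 𝒰 F), comparison 𝒰 F x = y := by
  obtain ⟨𝒰, ρ, rfl⟩ := exists_class₂_eq (F := toAbSheaf F) y
  exact ⟨𝒰, Submodule.Quotient.mk ⟨ρ.1, ρ.2⟩, rfl⟩

theorem exists_refine_eq_zero (F : X.Modules) {𝒰 : LevelTwoCover X.carrier} {x : coverH2 𝒰 F}
    (hx : comparison 𝒰 F x = 0) :
    ∃ (𝒰' : LevelTwoCover X.carrier) (r : 𝒰' ⟶ 𝒰), coverH2refine r F x = 0 := by
  obtain ⟨ρ, rfl⟩ := Submodule.Quotient.mk_surjective _ x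
  obtain ⟨𝒰', r, φ, hφ⟩ :=
    exists_refine_eq_abd1_of_class₂_eq_zero (F := toAbSheaf F) (ρ := toAbZ2 𝒰 F ρ) hx
  exact ⟨𝒰', r, (Submodule.Quotient.mk_eq_zero _).2 ⟨φ, Subtype.ext hφ⟩⟩

end AlgebraicGeometry.RingedSpace

/-! ### The colimit theorem -/

theorem theoremB (X : RingedSpace.{u, u}) :
    ∃ Φ : ∀ (𝒰 : LevelTwoCover X.carrier) (F : X.Modules),
        RingedSpace.coverH2 𝒰 F →ₗ[X.GlobalSections] RingedSpace.H2 F,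
      -- naturality in the module
      (∀ (𝒰 : LevelTwoCover X.carrier) (F G : X.Modules) (f : F ⟶ G)
        (x : RingedSpace.coverH2 𝒰 F),
        Φ 𝒰 G (RingedSpace.coverH2map 𝒰 f x) = RingedSpace.H2map f (Φ 𝒰 F x)) ∧
      -- compatibility with refinement
      ∃ hΦ : ∀ (F : X.Modules) (𝒰' 𝒰 : LevelTwoCover X.carrier) (r : 𝒰' ⟶ 𝒰)
        (x : RingedSpace.coverH2 𝒰 F),
        Φ 𝒰' F (RingedSpace.coverH2refine r F x) = Φ 𝒰 F x,
      -- `H²(X, ℱ)` is the colimit of the modules `H²(𝒰, ℱ)`, both over all refinements and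
      -- over the order-preserving refinements of covers with ordered index sets
      ∀ F : X.Modules,
        Nonempty (Limits.IsColimit
          (RingedSpace.cohomologyCocone F (fun 𝒰 => Φ 𝒰 F) (hΦ F))) ∧
        Nonempty (Limits.IsColimit
          ((RingedSpace.cohomologyCocone F (fun 𝒰 => Φ 𝒰 F) (hΦ F)).whisker
            (OrderedLevelTwoCover.forgetOrder X.carrier).op)) := by
  refine ⟨fun 𝒰 F => RingedSpace.comparison 𝒰 F, fun 𝒰 _ _ f x => RingedSpace.comparison_map 𝒰 f x,
    fun F _ _ r x => RingedSpace.comparison_refine F r x, fun F => ?_⟩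
  obtain ⟨h⟩ := ModuleCat.nonempty_isColimit_of_codirected (RingedSpace.cohomologyCocone F
      (fun 𝒰 => RingedSpace.comparison 𝒰 F) fun _ _ r x => RingedSpace.comparison_refine F r x)
    (fun 𝒰 𝒰' => ⟨𝒰.prod 𝒰', ⟨𝒰.prodFst 𝒰'⟩, ⟨𝒰.prodSnd 𝒰'⟩⟩)
    (RingedSpace.exists_comparison_eq F) fun _ _ hx => RingedSpace.exists_refine_eq_zero F hx
  -- The opposite of an initial functor is final, so restricting along it preserves the colimit.
  exact ⟨⟨h⟩, ⟨(Functor.Final.isColimitWhiskerEquiv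
    (OrderedLevelTwoCover.forgetOrder X.carrier).op _).symm h⟩⟩
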